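/- Let $G$ be a finite abelian group acting faithfully and diagonally on $\mathbb{C}^n$, let $R=\mathbb{C}[x_1,\dots,x_n]$ with the action $(g.f)(v)=f(g^{-1}v)$, let $X=\operatorname{Spec} R^G$, and let $\pi:Y\to X$ be a resolution ($Y$ an integral scheme, smooth over $\mathbb{C}$, $\pi$ proper and birational). Regard $K(Y)=K(X)$ as the subfield $K(\mathbb{C}^n)^G$ of the field $K(\mathbb{C}^n)$ of rational functions. A rational function $f\in K(\mathbb{C}^n)$ is $G$-homogeneous of weight $\rho(f)=\chi\in G^\vee=\operatorname{Hom}(G,\mathbb{C}^*)$ if $g.f=\chi(g^{-1})f$ for all $g\in G$. For a prime Weil divisor $P$ on $Y$ and a nonzero $G$-homogeneous $f$ put $v_P(f)=\frac{1}{|G|}v_P(f^{|G|})\in\mathbb{Q}$ and $(f)=\sum_P v_P(f)P$. A $\chi$-Weil divisor is a finite sum $D=\sum_P q_PP$ with $q_P\in\mathbb{Q}$ such that $q_P-v_P(f)\in\mathbb{Z}$ for every prime divisor $P$ and every nonzero $f$ of weight $\chi$; it is effective if all $q_P\ge 0$. For such a $D$ let $\mathcal{L}(-D)$ be the sub-$\mathcal{O}_Y$-module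 of the constant sheaf $K(\mathbb{C}^n)$ which is generated locally by the local equations of $D$, i.e. on an open set $U$ by the nonzero $f$ of weight $\chi$ with $v_P(f)=q_P$ for all $P$ meeting $U$. A subsheaf $\mathcal{F}$ of $\mathcal{O}_Y$-modules of the constant sheaf $K(\mathbb{C}^n)$, with its inclusion, is a deformation of the generic orbit of $G$ across $Y$ if it is closed under the actions of $G$ and $R$ on $K(\mathbb{C}^n)$, it is locally free, its fibre $\mathcal{F}\otimes k(p)$ at every point $p\in Y$ is, as a representation of $G$ over $k(p)$, isomorphic to the regular representation, and its stalk at the generic point of $Y$ is the whole of $K(\mathbb{C}^n)$. Let $\{D_\chi\}_{\chi\in G^\vee}$ be a family in which each $D_\chi$ is a $\chi$-Weil divisor on $Y$. Then $\bigoplus_\chi\mathcal{L}(-D_\chi)\subset K(\mathbb{C}^n)$ is a deformation of the generic orbit of $G$ across $Y$ if and only if for every nonzero $G$-homogeneous polynomial $f\in R$ and every $\chi\in G^\vee$ the divisor $$D_\chi+(f)-D_{\chi\rho(f)}$$ is effective. Moreover, it is sufficient to check this for the coordinate monomials: $\bigoplus_\chi\mathcal{L}(-D_\chi)$ is a deformation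 of the generic orbit if and only if $D_\chi+(x_i)-D_{\chi\rho(x_i)}$ is effective for all $i=1,\dots,n$ and all $\chi\in G^\vee$. -/

import Mathlib

open CategoryTheory AlgebraicGeometry TopologicalSpace
open scoped TensorProduct

/-- The coordinate ring `R = ℂ[x₁, …, xₙ]` of `ℂⁿ`. -/
abbrev CoordRing (n : ℕ) : Type := MvPolynomial (Fin n) ℂ

/-- The field `K(ℂⁿ)` of rational functions on `ℂⁿ`. -/
abbrev RatFun (n : ℕ) : Type := FractionRing (CoordRing n)

noncomputable section

namespace GConstellation

/-- A morphism to `Spec A` which is an isomorphism over a nonempty open subset induces an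
isomorphism of the local rings at the generic points. -/
theorem isIso_stalkMap_genericPoint {A : CommRingCat.{0}} [IsDomain A] {Y : Scheme.{0}} [IsIntegral Y] (π : Y ⟶ Spec A)
    (h : ∃ U : (Spec A).Opens, (U : Set (Spec A)).Nonempty ∧ IsIso (π ∣_ U)) :
    IsIso (π.stalkMap (genericPoint Y)) ∧ π (genericPoint Y) = genericPoint (Spec A) := by
  obtain ⟨U, hU, hiso⟩ := h
  have hne : Nonempty U := hU.to_subtype
  let y : (π ⁻¹ᵁ U).toScheme := (inv (π ∣_ U)) ⟨hU.some, hU.some_mem⟩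
  have hne' : Nonempty (π ⁻¹ᵁ U).toScheme := ⟨y⟩
  have hη : genericPoint Y ∈ π ⁻¹ᵁ U :=
    ((genericPoint_spec Y).mem_open_set_iff (π ⁻¹ᵁ U).isOpen).mpr ⟨y.1, trivial, y.2⟩
  have hint : IsIntegral (π ⁻¹ᵁ U).toScheme := isIntegral_of_isOpenImmersion (π ⁻¹ᵁ U).ι
  refine ⟨?_, ?_⟩
  · have e := morphismRestrictStalkMap π U (⟨genericPoint Y, hη⟩ : (π ⁻¹ᵁ U).toScheme)
    have h0 : IsOpenImmersion (π ∣_ U) := inferInstance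
    have h1 : ∀ x, IsIso ((π ∣_ U).stalkMap x) := fun x => inferInstance
    exact ((MorphismProperty.isomorphisms _).arrow_mk_iso_iff e).mp (h1 _)
  · have h1 := genericPoint_eq_of_isOpenImmersion (U.ι)
    have h2 := genericPoint_eq_of_isOpenImmersion ((π ⁻¹ᵁ U).ι)
    have h3 := genericPoint_eq_of_isOpenImmersion (π ∣_ U)
    rw [← h1, ← h2, ← h3]
    have h4 := morphismRestrict_ι π U
    rw [← Scheme.Hom.comp_apply, ← Scheme.Hom.comp_apply, h4]

/-- In this situation the function field of `Y` is the field of fractions of `A`. -/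
theorem isFractionRing_functionField {A : CommRingCat.{0}} [IsDomain A] {Y : Scheme.{0}} [IsIntegral Y] (π : Y ⟶ Spec A)
    (h : ∃ U : (Spec A).Opens, (U : Set (Spec A)).Nonempty ∧ IsIso (π ∣_ U)) :
    @IsFractionRing A _ Y.functionField _ ((Scheme.ΓSpecIso A).inv ≫ π.appTop ≫
    Y.presheaf.germ ⊤ (genericPoint Y) trivial).hom.toAlgebra := by
  obtain ⟨hiso, hη⟩ := isIso_stalkMap_genericPoint π h
  let x : PrimeSpectrum A := π (genericPoint Y)
  let alg : Algebra A Y.functionField := ((Scheme.ΓSpecIso A).inv ≫ π.appTop ≫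
    Y.presheaf.germ ⊤ (genericPoint Y) trivial).hom.toAlgebra
  have h1 := StructureSheaf.IsLocalization.to_stalk A x
  have h2 : x.asIdeal.primeCompl = nonZeroDivisors A := by
    have : x = ⊥ := by rw [← genericPoint_eq_bot_of_affine, ← hη]
    rw [this]
    ext
    exact mem_nonZeroDivisors_iff_ne_zero.symm
  have key : (Scheme.ΓSpecIso A).inv ≫ π.appTop ≫ Y.presheaf.germ ⊤ (genericPoint Y) trivial =
      StructureSheaf.toStalk A x ≫ π.stalkMap (genericPoint Y) := by
    exact congr((Scheme.ΓSpecIso A).inv ≫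
      $(Scheme.Hom.germ_stalkMap π ⊤ (genericPoint Y) trivial)).symm
  unfold IsLocalization.AtPrime at h1
  rw [h2] at h1
  exact @IsLocalization.isLocalization_of_algEquiv A _ (nonZeroDivisors A) _ _ _ _ _ alg h1
    { (asIso (π.stalkMap (genericPoint Y))).commRingCatIsoToRingEquiv with
      commutes' := fun r => congr($(key).hom r).symm }

section Action

variable {G : Type*} [CommGroup G] {n : ℕ}

/-! ### The group action

A representation of the finite abelian group `G` on `ℂⁿ`, diagonal in the chosen coordinates, is
given by `n` characters `w i : G →* ℂˣ`, via `g • (v₁, …, vₙ) = (w₁(g) v₁, …, wₙ(g) vₙ)`. It is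
faithful when only `1 : G` lies in the kernels of all the `w i`. -/

/-- Faithfulness of the diagonal representation with characters `w i`. -/
def IsFaithful (w : Fin n → (G →* ℂˣ)) : Prop :=
  ∀ g : G, (∀ i, w i g = 1) → g = 1

/-- The action `(g • f)(v) = f (g⁻¹ • v)` on polynomials, as an algebra homomorphism. -/
def actHom (w : Fin n → (G →* ℂˣ)) (g : G) : CoordRing n →ₐ[ℂ] CoordRing n :=
  MvPolynomial.aeval fun i => MvPolynomial.C ((w i g⁻¹ : ℂˣ) : ℂ) * MvPolynomial.X i

theorem actHom_comp (w : Fin n → (G →* ℂˣ)) (g h : G) :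
    (actHom w g).comp (actHom w h) = actHom w (g * h) := by
  apply MvPolynomial.algHom_ext
  intro i
  simp only [actHom, AlgHom.comp_apply, MvPolynomial.aeval_X, map_mul, MvPolynomial.algHom_C,
    MvPolynomial.algebraMap_eq, mul_inv, Units.val_mul]
  ring

theorem actHom_one (w : Fin n → (G →* ℂˣ)) : actHom w 1 = AlgHom.id ℂ (CoordRing n) := by
  apply MvPolynomial.algHom_ext
  intro i
  simp [actHom]

/-- The action `(g • f)(v) = f (g⁻¹ • v)` of `g : G` on `R`. -/
def act (w : Fin n → (G →* ℂˣ)) (g : G) : CoordRing n ≃ₐ[ℂ] CoordRing n :=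
  AlgEquiv.ofAlgHom (actHom w g) (actHom w g⁻¹)
    (by rw [actHom_comp, mul_inv_cancel, actHom_one])
    (by rw [actHom_comp, inv_mul_cancel, actHom_one])

/-- The induced action of `g : G` on the field `K(ℂⁿ)`. -/
def actK (w : Fin n → (G →* ℂˣ)) (g : G) : RatFun n ≃ₐ[ℂ] RatFun n :=
  IsFractionRing.fieldEquivOfAlgEquiv ℂ (RatFun n) (RatFun n) (act w g)

/-- `f ∈ K(ℂⁿ)` is `G`-homogeneous of weight `χ`: `g • f = χ(g⁻¹) f` for all `g`. -/
def HasWeight (w : Fin n → (G →* ℂˣ)) (χ : G →* ℂˣ) (f : RatFun n) : Prop :=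
  ∀ g : G, actK w g f = ((χ g⁻¹ : ℂˣ) : ℂ) • f

/-- The ring `R^G` of invariant polynomials. -/
def invariants (w : Fin n → (G →* ℂˣ)) : Subalgebra ℂ (CoordRing n) where
  carrier := {f | ∀ g : G, act w g f = f}
  mul_mem' ha hb g := by rw [map_mul, ha g, hb g]
  add_mem' ha hb g := by rw [map_add, ha g, hb g]
  algebraMap_mem' c g := (act w g).commutes c

/-- The quotient `X = ℂⁿ / G = Spec R^G`. -/
abbrev quot (w : Fin n → (G →* ℂˣ)) : Scheme.{0} :=
  Spec (CommRingCat.of (invariants w))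

/-- The structure morphism `X ⟶ Spec ℂ`. -/
def quotToC (w : Fin n → (G →* ℂˣ)) : quot w ⟶ Spec (CommRingCat.of ℂ) :=
  Spec.map (CommRingCat.ofHom (algebraMap ℂ (invariants w)))

/-- A resolution of `X = ℂⁿ / G`: an integral scheme `Y`, smooth over `ℂ`, with a proper
birational morphism `π : Y ⟶ X` (an isomorphism over a nonempty open subset of `X`). -/
structure Resolution (w : Fin n → (G →* ℂˣ)) where
  /-- the scheme `Y` -/
  Y : Scheme.{0}
  /-- the morphism `π : Y ⟶ X` -/
  π : Y ⟶ quot w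
  isIntegral : IsIntegral Y
  smooth : Smooth (π ≫ quotToC w)
  isProper : IsProper π
  birational : ∃ U : (quot w).Opens, (U : Set (quot w)).Nonempty ∧ IsIso (π ∣_ U)

end Action

namespace Resolution

variable {G : Type*} [CommGroup G] {n : ℕ} {w : Fin n → (G →* ℂˣ)} (Y : Resolution w)

instance : IsIntegral Y.Y := Y.isIntegral

instance : IsLocallyNoetherian Y.Y :=
  haveI := Y.smooth
  LocallyOfFiniteType.isLocallyNoetherian (Y.π ≫ quotToC w)

/-! ### The embedding of `K(Y) = K(ℂⁿ)^G` into `K(ℂⁿ)` -/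

/-- Pullback of invariant polynomials to rational functions on `Y`, along `π`. -/
def pullbackInv : invariants w →+* Y.Y.functionField :=
  ((Scheme.ΓSpecIso (CommRingCat.of (invariants w))).inv ≫ Y.π.appTop ≫
    Y.Y.presheaf.germ ⊤ (genericPoint Y.Y) trivial).hom

/-- As `π` is birational, `K(Y)` is the field of fractions of `R^G`. -/
theorem isFractionRing_pullbackInv :
    @IsFractionRing (invariants w) _ Y.Y.functionField _ Y.pullbackInv.toAlgebra :=
  isFractionRing_functionField (A := CommRingCat.of (invariants w)) Y.π Y.birational

/-- The inclusion `R^G ⊆ K(ℂⁿ)`. -/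
def invToRatFun (w : Fin n → (G →* ℂˣ)) : invariants w →+* RatFun n :=
  (algebraMap (CoordRing n) (RatFun n)).comp (invariants w).subtype

theorem invToRatFun_injective (w : Fin n → (G →* ℂˣ)) : Function.Injective (invToRatFun w) :=
  (IsFractionRing.injective (CoordRing n) (RatFun n)).comp Subtype.val_injective

/-- The embedding `K(Y) = K(X) = K(ℂⁿ)^G ⊆ K(ℂⁿ)`: the unique ring homomorphism which sends
`π^* f` to `f` for every `f ∈ R^G`. -/
def toRatFun : Y.Y.functionField →+* RatFun n :=
  letI : Algebra (invariants w) Y.Y.functionField := Y.pullbackInv.toAlgebra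
  haveI : IsFractionRing (invariants w) Y.Y.functionField := Y.isFractionRing_pullbackInv
  IsFractionRing.lift (A := invariants w) (K := Y.Y.functionField) (invToRatFun_injective w)

/-- The characterising property of the embedding `K(Y) ⊆ K(ℂⁿ)`. -/
theorem toRatFun_pullbackInv (f : invariants w) :
    Y.toRatFun (Y.pullbackInv f) = algebraMap (CoordRing n) (RatFun n) f := by
  let _ : Algebra (invariants w) Y.Y.functionField := Y.pullbackInv.toAlgebra
  have _ : IsFractionRing (invariants w) Y.Y.functionField := Y.isFractionRing_pullbackInv
  exact IsFractionRing.lift_algebraMap (A := invariants w) (K := Y.Y.functionField)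
    (invToRatFun_injective w) f

/-- The ring `𝒪_Y(U)` of regular functions on a nonempty open set `U`, inside `K(ℂⁿ)`. -/
def regular (U : Y.Y.Opens) [Nonempty U] : Subring (RatFun n) :=
  (Y.toRatFun.comp (Y.Y.germToFunctionField U).hom).range

/-- The local ring `𝒪_{Y,p}`, inside `K(ℂⁿ)`. -/
def localRing (p : Y.Y) : Subring (RatFun n) :=
  (Y.toRatFun.comp (algebraMap (Y.Y.presheaf.stalk p) Y.Y.functionField)).range

instance (p : Y.Y) : IsLocalRing (Y.localRing p) :=
  IsLocalRing.of_surjective' _ (RingHom.rangeRestrict_surjective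
    (Y.toRatFun.comp (algebraMap (Y.Y.presheaf.stalk p) Y.Y.functionField)))

theorem regular_mono {U V : Y.Y.Opens} [Nonempty U] [Nonempty V] (h : V ≤ U) :
    Y.regular U ≤ Y.regular V := by
  rintro _ ⟨a, rfl⟩
  refine ⟨Y.Y.presheaf.map (homOfLE h).op a, ?_⟩
  simp only [RingHom.comp_apply]
  congr 1
  exact Y.Y.presheaf.germ_res_apply (homOfLE h) _ _ a

/-! ### Divisors -/

/-- A prime Weil divisor on `Y`, given by its generic point: a point of codimension `1`. -/
def PrimeDivisor : Type := {p : Y.Y // Order.coheight p = 1}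

/-- The `ℚ`-valued valuation `v_P(f) = v_P(f^|G|) / |G|` of a nonzero `G`-homogeneous rational
function `f`. Here `f^|G|` is invariant, so it is the image of a (unique) element of `K(Y)`. -/
def val (P : Y.PrimeDivisor) (f : RatFun n) : ℚ :=
  (Scheme.ord (Function.invFun Y.toRatFun (f ^ Nat.card G)) P.1 : ℚ) / (Nat.card G : ℚ)

/-- The principal divisor `(f) = ∑ v_P(f) P` of a nonzero `G`-homogeneous rational function, as
the function `P ↦ v_P(f)` of coefficients. -/
def principal (f : RatFun n) : Y.PrimeDivisor → ℚ := fun P => Y.val P f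

/-- A finite `ℚ`-combination `∑ q_P P` of prime divisors is a `χ`-Weil divisor if
`q_P - v(P, χ) ∈ ℤ` for all `P`, where `v(P, χ)` is the fractional part of `v_P(f)` for
any nonzero `f` of weight `χ`. -/
def IsWeilDivisor (χ : G →* ℂˣ) (D : Y.PrimeDivisor →₀ ℚ) : Prop :=
  ∀ P : Y.PrimeDivisor, ∀ f : RatFun n, f ≠ 0 → HasWeight w χ f →
    ∃ k : ℤ, D P - Int.fract (Y.val P f) = k

/-- A divisor, given by its coefficients, is effective if all of them are nonnegative. -/
def IsEffective (E : Y.PrimeDivisor → ℚ) : Prop := ∀ P, 0 ≤ E P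

/-- A prereductor set: one `χ`-Weil divisor for each character `χ` of `G`. -/
def IsPrereductorSet (D : (G →* ℂˣ) → (Y.PrimeDivisor →₀ ℚ)) : Prop :=
  ∀ χ, Y.IsWeilDivisor χ (D χ)

/-! ### The sheaves `𝓛(-D)` -/

/-- `f` is a local equation on `U` of the `χ`-divisor `D`: a nonzero rational function of
weight `χ` with `v_P(f)` equal to the coefficient of `P` in `D` whenever `P` meets `U`. -/
def IsLocalEquation (χ : G →* ℂˣ) (D : Y.PrimeDivisor →₀ ℚ) (U : Y.Y.Opens) (f : RatFun n) :
    Prop :=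
  f ≠ 0 ∧ HasWeight w χ f ∧ ∀ P : Y.PrimeDivisor, P.1 ∈ U → Y.val P f = D P

theorem span_localEquation_mono (χ : G →* ℂˣ) (D : Y.PrimeDivisor →₀ ℚ) {U V : Y.Y.Opens}
    [Nonempty U] [Nonempty V] (h : V ≤ U) {s : RatFun n}
    (hs : s ∈ Submodule.span (Y.regular U) {f | Y.IsLocalEquation χ D U f}) :
    s ∈ Submodule.span (Y.regular V) {f | Y.IsLocalEquation χ D V f} := by
  induction hs using Submodule.span_induction with
  | mem f hf => exact Submodule.subset_span ⟨hf.1, hf.2.1, fun P hP => hf.2.2 P (h hP)⟩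
  | zero => exact zero_mem _
  | add x y _ _ hx hy => exact add_mem hx hy
  | smul a x _ hx => exact Submodule.smul_mem _ (⟨a.1, Y.regular_mono h a.2⟩ : Y.regular V) hx

/-- The sections over `U` of the sheaf `𝓛(-D)`: the sub-`𝒪_Y`-module of the constant sheaf
`K(ℂⁿ)` which is generated, locally on `Y`, by the local equations of the `χ`-divisor `D`. -/
def lineSheaf (χ : G →* ℂˣ) (D : Y.PrimeDivisor →₀ ℚ) (U : Y.Y.Opens) [Nonempty U] :
    Submodule (Y.regular U) (RatFun n) where
  carrier := {s | ∀ y ∈ U, ∃ (V : Y.Y.Opens) (_ : Nonempty V), y ∈ V ∧ V ≤ U ∧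
    s ∈ Submodule.span (Y.regular V) {f | Y.IsLocalEquation χ D V f}}
  zero_mem' y hy := ⟨U, ⟨⟨y, hy⟩⟩, hy, le_rfl, zero_mem _⟩
  add_mem' {s t} hs ht y hy := by
    obtain ⟨V, _, hyV, hVU, hsV⟩ := hs y hy
    obtain ⟨W, _, hyW, hWU, htW⟩ := ht y hy
    have hne : Nonempty (V ⊓ W : Y.Y.Opens) := ⟨⟨y, hyV, hyW⟩⟩
    exact ⟨V ⊓ W, hne, ⟨hyV, hyW⟩, inf_le_left.trans hVU,
      add_mem (Y.span_localEquation_mono χ D inf_le_left hsV)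
        (Y.span_localEquation_mono χ D inf_le_right htW)⟩
  smul_mem' a s hs y hy := by
    obtain ⟨V, _, hyV, hVU, hsV⟩ := hs y hy
    exact ⟨V, inferInstance, hyV, hVU,
      Submodule.smul_mem _ (⟨a.1, Y.regular_mono hVU a.2⟩ : Y.regular V) hsV⟩

/-- The sections over `U` of `⨁_χ 𝓛(-D_χ) ⊆ K(ℂⁿ)`. The sum inside `K(ℂⁿ)` is direct, since the
summands consist of functions of different weights. -/
def sumLineSheaf (D : (G →* ℂˣ) → (Y.PrimeDivisor →₀ ℚ)) (U : Y.Y.Opens) [Nonempty U] :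
    Submodule (Y.regular U) (RatFun n) :=
  ⨆ χ : G →* ℂˣ, Y.lineSheaf χ (D χ) U

/-! ### Deformations of the generic orbit inside `K(ℂⁿ)`

In the following, `F` assigns to each nonempty open `U ⊆ Y` an `𝒪_Y(U)`-submodule of `K(ℂⁿ)`.
(As `Y` is irreducible, `K(ℂⁿ)` is the value on `U` of the constant sheaf `K(ℂⁿ)`.) -/

/-- `F` is a subsheaf of the constant sheaf `K(ℂⁿ)`. -/
def IsSubsheaf (F : ∀ (U : Y.Y.Opens) [Nonempty U], Submodule (Y.regular U) (RatFun n)) : Prop :=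
  ∀ (U : Y.Y.Opens) [Nonempty U] (s : RatFun n),
    (∀ (V : Y.Y.Opens) [Nonempty V], V ≤ U → s ∈ F U → s ∈ F V) ∧
    ((∀ y ∈ U, ∃ (V : Y.Y.Opens) (_ : Nonempty V), y ∈ V ∧ V ≤ U ∧ s ∈ F V) → s ∈ F U)

/-- `F` is locally free: each point has an open neighbourhood `U` on which there are finitely
many sections whose restrictions to every nonempty open `V ⊆ U` are a basis of `F(V)`. -/
def IsLocallyFree (F : ∀ (U : Y.Y.Opens) [Nonempty U], Submodule (Y.regular U) (RatFun n)) :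
    Prop :=
  ∀ y : Y.Y, ∃ U : Y.Y.Opens, y ∈ U ∧ ∃ (r : ℕ) (e : Fin r → RatFun n),
    ∀ (V : Y.Y.Opens) [Nonempty V], V ≤ U →
      ∃ b : Module.Basis (Fin r) (Y.regular V) (F V), ∀ i, (b i : RatFun n) = e i

/-- The stalk `F_p`, an `𝒪_{Y,p}`-submodule of `K(ℂⁿ)` (for a subsheaf `F`, the union of all
`F(U)` with `p ∈ U` is already closed under the module operations). -/
def stalk (F : ∀ (U : Y.Y.Opens) [Nonempty U], Submodule (Y.regular U) (RatFun n)) (p : Y.Y) :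
    Submodule (Y.localRing p) (RatFun n) :=
  Submodule.span _ {s | ∃ (U : Y.Y.Opens) (_ : Nonempty U), p ∈ U ∧ s ∈ F U}

/-- The residue field `k(p)`. -/
abbrev residueField (p : Y.Y) : Type := IsLocalRing.ResidueField (Y.localRing p)

/-- The fibre `F_p ⊗ k(p)` with its induced `G`-action is isomorphic to the regular
representation of `G` over `k(p)`. -/
def IsRegularFibre (F : ∀ (U : Y.Y.Opens) [Nonempty U], Submodule (Y.regular U) (RatFun n))
    (p : Y.Y) : Prop :=
  ∃ e : (Y.residueField p ⊗[Y.localRing p] Y.stalk F p) ≃ₗ[Y.residueField p]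
      MonoidAlgebra (Y.residueField p) G,
    ∀ (g : G) (c : Y.residueField p) (s t : Y.stalk F p), (t : RatFun n) = actK w g s →
      e (c ⊗ₜ t) = MonoidAlgebra.single g 1 * e (c ⊗ₜ s)

/-- `F`, with its inclusion into the constant sheaf `K(ℂⁿ)`, is a deformation of the generic orbit
of `G` across `Y`: a family of `G`-constellations on `Y`, with the actions of `G` and `R` for which
the inclusion is equivariant, such that the inclusion induces an isomorphism from the fibre at the
generic point of `Y` onto `K(ℂⁿ)`. -/
structure IsDeformationOfGenericOrbit
    (F : ∀ (U : Y.Y.Opens) [Nonempty U], Submodule (Y.regular U) (RatFun n)) : Prop where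
  isSubsheaf : Y.IsSubsheaf F
  /-- `G` acts on `F` -/
  act_mem : ∀ (U : Y.Y.Opens) [Nonempty U] (g : G) (s : RatFun n), s ∈ F U → actK w g s ∈ F U
  /-- `R` acts on `F` -/
  mul_mem : ∀ (U : Y.Y.Opens) [Nonempty U] (f : CoordRing n) (s : RatFun n), s ∈ F U →
    algebraMap (CoordRing n) (RatFun n) f * s ∈ F U
  isLocallyFree : Y.IsLocallyFree F
  /-- every fibre is a `G`-constellation -/
  isRegularFibre : ∀ p : Y.Y, Y.IsRegularFibre F p
  /-- the generic fibre is `K(ℂⁿ)` -/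
  stalk_genericPoint : Y.stalk F (genericPoint Y.Y) = ⊤

/-- `{D_χ}` is a reductor set: `⨁_χ 𝓛(-D_χ)` with its inclusion into `K(ℂⁿ)` is a deformation of
the generic orbit. -/
def IsReductorSet (D : (G →* ℂˣ) → (Y.PrimeDivisor →₀ ℚ)) : Prop :=
  Y.IsPrereductorSet D ∧ Y.IsDeformationOfGenericOrbit fun U [Nonempty U] => Y.sumLineSheaf D U

end Resolution

end GConstellation

end

open GConstellation

/-! Near every point of `Y` each `D_χ` has a local equation `e_χ`, and there `𝓛(-D_χ)` is free on
`e_χ`. So `⨁_χ 𝓛(-D_χ)` is locally free with one basis vector of each weight. For an arbitrary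
family of `χ`-Weil divisors it is therefore `G`-stable, its fibres are regular representations, and
its generic stalk is `K(ℂⁿ)`. Only stability under `R` remains. A polynomial `f` of weight `ψ` sends
`e_χ` to a function of weight `χψ`, so stability under `f` means that every quotient `f e_χ /
e_{χψ}` is regular. This quotient is invariant, hence lies in `K(Y)`, and its order along `P` is the
coefficient of `P` in `D_χ + (f) - D_{χψ}`. It is regular exactly when these orders are nonnegative.
Since `R` is generated by the constants and the `x_i`, the coordinates suffice.

Two facts carry the argument. Functions of every weight exist, by faithfulness and Dedekind's
independence of automorphisms (`exists_ne_zero_hasWeight`). Prime divisors on `Y` are locally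
principal and functions without poles are regular, because the local rings of a smooth variety are
factorial.

Factoriality is obtained by completion. Power series rings over an infinite field are factorial by
Weierstrass preparation (`MvPowerSeries.uniqueFactorizationMonoid_fin`). Étale coordinates identify
the completed local ring at a closed point with a power series ring
(`AdicCompletion.nonempty_ringEquiv_of_formallyEtale`). Factoriality then descends along the
faithfully flat completion (`UniqueFactorizationMonoid.of_faithfullyFlat`) and passes to further
localizations. -/

noncomputable section

/-! ### Weierstrass preparation and prime power series -/

section PowerSeriesFactorial

/-- A monic factor of a distinguished polynomial over a local ring is distinguished. -/
theorem Polynomial.IsDistinguishedAt.of_monic_of_dvd {R : Type*} [CommRing R] [IsLocalRing R]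
    {f q : Polynomial R} (hf : f.IsDistinguishedAt (IsLocalRing.maximalIdeal R))
    (hq : q.Monic) (h : q ∣ f) : q.IsDistinguishedAt (IsLocalRing.maximalIdeal R) := by
  have h1 : q.map (IsLocalRing.residue R) ∣ Polynomial.X ^ f.natDegree := by
    have h2 : f.map (IsLocalRing.residue R) = Polynomial.X ^ f.natDegree := hf.map_eq_X_pow
    rw [← h2]
    exact Polynomial.map_dvd _ h
  obtain ⟨k, -, hk⟩ := (dvd_prime_pow Polynomial.prime_X _).mp h1
  have h2 : q.map (IsLocalRing.residue R) = Polynomial.X ^ k :=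
    Polynomial.eq_of_monic_of_associated (hq.map _) (Polynomial.monic_X_pow k) hk
  have h3 : k = q.natDegree := by
    rw [← hq.natDegree_map (IsLocalRing.residue R), h2, Polynomial.natDegree_X_pow]
  refine ⟨⟨fun {i} hi => ?_⟩, hq⟩
  rw [← IsLocalRing.residue_eq_zero_iff, ← Polynomial.coeff_map, h2, Polynomial.coeff_X_pow,
    if_neg (by omega)]

/-- An irreducible distinguished polynomial over a complete factorial local ring is a prime power
series. -/
theorem Polynomial.IsDistinguishedAt.prime_coe {R : Type*} [CommRing R] [IsDomain R] {I : Ideal R}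
    [IsAdicComplete I R] {q : Polynomial R} (hq : q.IsDistinguishedAt I) (h : Prime q) :
    Prime (q : PowerSeries R) := by
  have h0 : (q : PowerSeries R) ≠ 0 := by
    rw [Ne, Polynomial.coe_eq_zero_iff]
    exact h.ne_zero
  rw [← Ideal.span_singleton_prime h0, ← Ideal.Quotient.isDomain_iff_prime]
  have : (Ideal.span {q}).IsPrime := (Ideal.span_singleton_prime h.ne_zero).mpr h
  have := (Ideal.Quotient.isDomain_iff_prime (Ideal.span {q})).mpr this
  -- Weierstrass division by `q` identifies `R[X]/(q)` with `R⟦X⟧/(q)`.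
  exact hq.algEquivQuotient.symm.toMulEquiv.isDomain _

/-- By Weierstrass preparation `g` is a unit times a distinguished polynomial, and some prime factor
of this polynomial in `R[X]` lies in `p`. Made monic, that factor is again distinguished, so it
stays prime as a power series. -/
theorem PowerSeries.exists_prime_mem_of_map_residue_ne_zero {R : Type*} [CommRing R] [IsDomain R]
    [IsLocalRing R] [UniqueFactorizationMonoid R] [IsAdicComplete (IsLocalRing.maximalIdeal R) R]
    {g : PowerSeries R} (hg : g.map (IsLocalRing.residue R) ≠ 0) {p : Ideal (PowerSeries R)}
    [hp : p.IsPrime] (hgp : g ∈ p) : ∃ q ∈ p, Prime q := by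
  obtain ⟨f, h, hf, hh, rfl⟩ := PowerSeries.exists_isWeierstrassFactorization hg
  have hfp : (f : PowerSeries R) ∈ p := (hp.mem_or_mem hgp).resolve_right
    fun h' => hp.ne_top (Ideal.eq_top_of_isUnit_mem _ h' hh)
  obtain ⟨s, hs, hsf⟩ := UniqueFactorizationMonoid.exists_prime_factors f hf.monic.ne_zero
  let P : Ideal (Polynomial R) := p.comap Polynomial.coeToPowerSeries.ringHom
  have hP : P.IsPrime := Ideal.comap_isPrime _ _
  have hsP : s.prod ∈ P := (Ideal.mem_iff_of_associated hsf).mpr hfp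
  obtain ⟨q, hqs, hqP⟩ := (hP.multiset_prod_mem_iff_exists_mem s).mp hsP
  have hqf : q ∣ f := (Multiset.dvd_prod hqs).trans hsf.dvd
  -- The leading coefficient of a factor of a monic polynomial is a unit, so `q` can be made monic.
  obtain ⟨u, hu⟩ : IsUnit q.leadingCoeff := by
    obtain ⟨r, rfl⟩ := hqf
    have := hf.monic.leadingCoeff
    rw [Polynomial.leadingCoeff_mul] at this
    exact IsUnit.of_mul_eq_one _ this
  have hmon : (Polynomial.C (↑u⁻¹ : R) * q).Monic := by
    rw [Polynomial.Monic, Polynomial.leadingCoeff_mul, Polynomial.leadingCoeff_C, ← hu,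
      Units.inv_mul]
  have hCu : IsUnit (Polynomial.C (↑u⁻¹ : R)) := Polynomial.isUnit_C.mpr (Units.isUnit _)
  have hass : Associated q (Polynomial.C (↑u⁻¹ : R) * q) := ⟨hCu.unit, mul_comm _ _⟩
  have hd := hf.of_monic_of_dvd hmon (hass.symm.dvd.trans hqf)
  exact ⟨_, P.mul_mem_left _ hqP, hd.prime_coe (hass.prime (hs q hqs))⟩

end PowerSeriesFactorial

/-! ### Formal power series over an infinite field are factorial -/

theorem MvPolynomial.isMaximal_idealOfVars (k : Type*) [Field k] (σ : Type*) :
    (MvPolynomial.idealOfVars σ k).IsMaximal := by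
  have : MvPolynomial.idealOfVars σ k = RingHom.ker (MvPolynomial.constantCoeff (σ := σ) (R := k)) := by
    ext p
    have := MvPolynomial.mem_pow_idealOfVars_iff' (σ := σ) (R := k) 1 p
    rw [pow_one] at this
    rw [this, RingHom.mem_ker, MvPolynomial.constantCoeff_eq]
    refine ⟨fun h => h 0 (by simp), fun h x hx => ?_⟩
    have : x = 0 := by
      rw [← Finsupp.degree_eq_zero_iff]
      omega
    rw [this, h]
  rw [this]
  exact RingHom.ker_isMaximal_of_surjective _ fun c => ⟨MvPolynomial.C c, by simp⟩

namespace MvPowerSeries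

/-- The power series ring is the completion of the polynomial ring at the ideal of the variables.
The extension of that ideal is maximal, hence it is the maximal ideal of the local ring. -/
theorem isAdicComplete_maximalIdeal (k : Type*) [Field k] (σ : Type*) [Finite σ] :
    IsAdicComplete (IsLocalRing.maximalIdeal (MvPowerSeries σ k)) (MvPowerSeries σ k) := by
  let I := MvPolynomial.idealOfVars σ k
  have hI : I.FG := MvPolynomial.idealOfVars_fg ..
  have : I.IsMaximal := MvPolynomial.isMaximal_idealOfVars k σ
  have h1 := AdicCompletion.isMaximal_map_of_le I I le_rfl hI
  have h2 := AdicCompletion.isAdicComplete_self I hI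
  let e := (toAdicCompletionAlgEquiv σ k).symm.toRingEquiv
  have h3 := (IsAdicComplete.congr_ringEquiv _ e).mpr h2
  have h4 : ((I.map (algebraMap _ (AdicCompletion I (MvPolynomial σ k)))).map e).IsMaximal :=
    Ideal.map_isMaximal_of_equiv e
  rwa [IsLocalRing.eq_maximalIdeal h4] at h3


variable {k : Type*} [Field k] {n : ℕ}

/-- The values `c₀ X₀`, `X_{i+1} + c_{i+1} X₀` of the variables under a linear change of
coordinates. -/
def shearVar (c : Fin (n + 1) → k) : Fin (n + 1) → MvPowerSeries (Fin (n + 1)) k :=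
  Fin.cons (C (c 0) * X 0) fun i => X i.succ + C (c i.succ) * X 0

theorem shearVar_zero (c : Fin (n + 1) → k) : shearVar c 0 = C (c 0) * X 0 := rfl

theorem shearVar_succ (c : Fin (n + 1) → k) (i : Fin n) :
    shearVar c i.succ = X i.succ + C (c i.succ) * X 0 := rfl

theorem hasSubst_shearVar (c : Fin (n + 1) → k) : HasSubst (shearVar c) := by
  refine hasSubst_of_constantCoeff_zero fun s => ?_
  refine Fin.cases ?_ (fun i => ?_) s <;> simp [shearVar]

theorem subst_shearVar_shearVar (c d : Fin (n + 1) → k) (h0 : c 0 * d 0 = 1)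
    (h : ∀ i : Fin n, d i.succ + c i.succ * d 0 = 0) :
    (fun s => substAlgHom (hasSubst_shearVar d) (shearVar c s)) = X := by
  have hC (r : k) : substAlgHom (R := k) (hasSubst_shearVar d) (C r) = C r :=
    (substAlgHom (hasSubst_shearVar d)).commutes r
  funext s
  refine Fin.cases ?_ (fun i => ?_) s
  · rw [shearVar_zero, map_mul, substAlgHom_X, hC, shearVar_zero, ← mul_assoc, ← map_mul, h0,
      map_one, one_mul]
  · rw [shearVar_succ, map_add, map_mul, substAlgHom_X, substAlgHom_X, hC, shearVar_zero,
      shearVar_succ, ← mul_assoc, ← map_mul, add_assoc, ← add_mul, ← map_add, h i, map_zero,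
      zero_mul, add_zero]

/-- The linear change of coordinates `X₀ ↦ c₀ X₀`, `X_{i+1} ↦ X_{i+1} + c_{i+1} X₀`. -/
def shearEquiv (c : Fin (n + 1) → k) (hc : c 0 ≠ 0) :
    MvPowerSeries (Fin (n + 1)) k ≃ₐ[k] MvPowerSeries (Fin (n + 1)) k :=
  let d : Fin (n + 1) → k := Fin.cons (c 0)⁻¹ fun i => - (c i.succ * (c 0)⁻¹)
  AlgEquiv.ofAlgHom (substAlgHom (hasSubst_shearVar c)) (substAlgHom (hasSubst_shearVar d))
    (by
      ext1 f
      have := substAlgHom_comp_substAlgHom_apply (R := k) (hasSubst_shearVar d)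
        (hasSubst_shearVar c) f
      rw [AlgHom.comp_apply, this, substAlgHom_apply,
        subst_shearVar_shearVar d c (by simp [d, hc]) (by intro i; simp [d, hc]), subst_self]
      rfl)
    (by
      ext1 f
      have := substAlgHom_comp_substAlgHom_apply (R := k) (hasSubst_shearVar c)
        (hasSubst_shearVar d) f
      rw [AlgHom.comp_apply, this, substAlgHom_apply,
        subst_shearVar_shearVar c d (by simp [d, hc]) (by intro i; simp [d]), subst_self]
      rfl)

theorem shearEquiv_apply (c : Fin (n + 1) → k) (hc : c 0 ≠ 0) (f : MvPowerSeries (Fin (n + 1)) k) :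
    shearEquiv c hc f = subst (shearVar c) f := by
  rw [← coe_substAlgHom (hasSubst_shearVar c)]; rfl

/-- Restriction of a power series to the axis of `X₀`. -/
def toAxis : MvPowerSeries (Fin (n + 1)) k →+* PowerSeries k :=
  (PowerSeries.map constantCoeff).comp (finSuccEquiv k n).toRingEquiv.toRingHom

theorem toAxis_shearVar (c : Fin (n + 1) → k) (s : Fin (n + 1)) :
    toAxis (shearVar c s) = PowerSeries.C (c s) * PowerSeries.X := by
  refine Fin.cases ?_ (fun i => ?_) s <;> simp [toAxis, shearVar]

theorem coeff_toAxis (f : MvPowerSeries (Fin (n + 1)) k) (r : ℕ) :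
    PowerSeries.coeff r (toAxis f) = coeff (Finsupp.cons r 0) f := by
  simp [toAxis, ← coeff_coeff_finSuccEquiv]

/-- On the axis the sheared variables become `c_s X`, so the coefficient of `X^r` is the value at
`c` of the homogeneous part of `f` of degree `r`. -/
theorem coeff_toAxis_shearEquiv (c : Fin (n + 1) → k) (hc : c 0 ≠ 0)
    (f : MvPowerSeries (Fin (n + 1)) k) (r : ℕ) :
    PowerSeries.coeff r (toAxis (shearEquiv c hc f)) =
      MvPolynomial.eval c (∑ d ∈ Finset.finsuppAntidiag Finset.univ r,
        MvPolynomial.monomial d (coeff d f)) := by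
  have key (d : Fin (n + 1) →₀ ℕ) : coeff (Finsupp.cons r 0) (d.prod fun s e => shearVar c s ^ e) =
      if d.degree = r then d.prod fun s e => c s ^ e else 0 := by
    rw [← coeff_toAxis, Finsupp.prod, map_prod]
    simp only [map_pow, toAxis_shearVar, mul_pow]
    rw [Finset.prod_mul_distrib, Finset.prod_pow_eq_pow_sum, ← Finsupp.degree_apply]
    simp only [← map_pow, ← map_prod]
    rw [PowerSeries.coeff_C_mul, PowerSeries.coeff_X_pow]
    simp [Finsupp.prod, eq_comm]
  rw [coeff_toAxis, shearEquiv_apply, coeff_subst (hasSubst_shearVar c), map_sum]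
  simp only [key, MvPolynomial.eval_monomial]
  rw [finsum_eq_sum_of_support_subset (s := Finset.finsuppAntidiag Finset.univ r)]
  · refine Finset.sum_congr rfl fun d hd => ?_
    rw [if_pos, smul_eq_mul]
    rw [Finset.mem_finsuppAntidiag] at hd
    rw [Finsupp.degree_eq_sum, hd.1]
  · intro d hd
    rw [Finset.mem_coe, Finset.mem_finsuppAntidiag]
    refine ⟨?_, Finset.subset_univ _⟩
    by_contra h
    rw [← Finsupp.degree_eq_sum] at h
    simp [h] at hd

/-- After a linear change of coordinates a nonzero power series is regular in the first
variable. -/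
theorem exists_toAxis_shearEquiv_ne_zero [Infinite k] {f : MvPowerSeries (Fin (n + 1)) k}
    (hf : f ≠ 0) : ∃ (c : Fin (n + 1) → k) (hc : c 0 ≠ 0), toAxis (shearEquiv c hc f) ≠ 0 := by
  obtain ⟨d, hd⟩ : ∃ d, coeff d f ≠ 0 := by
    by_contra! h
    exact hf (MvPowerSeries.ext h)
  let p : MvPolynomial (Fin (n + 1)) k := ∑ e ∈ Finset.finsuppAntidiag Finset.univ d.degree,
    MvPolynomial.monomial e (coeff e f)
  have hp : p ≠ 0 := by
    intro h
    apply hd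
    have := congrArg (MvPolynomial.coeff d) h
    simp only [p, MvPolynomial.coeff_sum, MvPolynomial.coeff_monomial, Finset.sum_ite_eq'] at this
    rwa [if_pos, MvPolynomial.coeff_zero] at this
    rw [Finset.mem_finsuppAntidiag]
    exact ⟨(Finsupp.degree_eq_sum d).symm, Finset.subset_univ _⟩
  -- The factor `X 0` forces `c 0 ≠ 0`, which makes the shear invertible.
  obtain ⟨c, hc⟩ : ∃ c, MvPolynomial.eval c (p * MvPolynomial.X 0) ≠ 0 := by
    by_contra! h
    exact mul_ne_zero hp (MvPolynomial.X_ne_zero 0) (MvPolynomial.funext fun c => by simp [h c])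
  rw [map_mul, MvPolynomial.eval_X] at hc
  refine ⟨c, right_ne_zero_of_mul hc, fun h => left_ne_zero_of_mul hc ?_⟩
  rw [← coeff_toAxis_shearEquiv c (right_ne_zero_of_mul hc), h, map_zero]

/-- Induction on `n` with Kaplansky's criterion: a domain is factorial if every nonzero prime ideal
contains a prime element. After a shear, an element of the ideal is regular in the first variable,
and Weierstrass preparation over the ring in the other variables supplies the prime. -/
theorem uniqueFactorizationMonoid_fin (k : Type*) [Field k] [Infinite k] (n : ℕ) :
    UniqueFactorizationMonoid (MvPowerSeries (Fin n) k) := by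
  have hdom (m : ℕ) : IsDomain (MvPowerSeries (Fin m) k) := NoZeroDivisors.to_isDomain _
  induction n with
  | zero =>
    exact (isEmptyEquiv (R := k) (σ := Fin 0)).symm.toMulEquiv.uniqueFactorizationMonoid inferInstance
  | succ n ih =>
    have := isAdicComplete_maximalIdeal k (Fin n)
    rw [UniqueFactorizationMonoid.iff_exists_prime_mem_of_isPrime]
    intro I hI hIp
    obtain ⟨f, hfI, hf⟩ := Submodule.exists_mem_ne_zero_of_ne_bot hI
    obtain ⟨c, hc, h⟩ := exists_toAxis_shearEquiv_ne_zero hf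
    let e : MvPowerSeries (Fin (n + 1)) k ≃+* PowerSeries (MvPowerSeries (Fin n) k) :=
      (shearEquiv c hc).toRingEquiv.trans (finSuccEquiv k n).toRingEquiv
    -- Reducing the coefficients modulo the maximal ideal amounts to restricting to the axis of
    -- `X₀`.
    have h1 : (e f).map (IsLocalRing.residue _) ≠ 0 := by
      intro h0
      apply h
      ext r
      have h2 : IsLocalRing.residue _ (PowerSeries.coeff r (e f)) = 0 := by
        rw [← PowerSeries.coeff_map, h0, map_zero]
      rw [IsLocalRing.residue_eq_zero_iff, IsLocalRing.mem_maximalIdeal, mem_nonunits_iff,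
        isUnit_iff_constantCoeff, isUnit_iff_ne_zero, not_not] at h2
      simpa [toAxis, e] using h2
    obtain ⟨q, hq, hqp⟩ := PowerSeries.exists_prime_mem_of_map_residue_ne_zero
      (p := I.comap (e.symm : _ →+* _)) h1 (by simpa [Ideal.mem_comap] using hfI)
    exact ⟨e.symm q, hq, (MulEquiv.prime_iff e.symm.toMulEquiv).mpr hqp⟩

end MvPowerSeries

end

noncomputable section

/-! ### Descent of factoriality along faithfully flat extensions -/

section FactorialDescent

variable {A B : Type*} [CommRing A] [CommRing B] [Algebra A B]

/-- Flat extensions commute with colon ideals of elements. -/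
theorem Ideal.mem_map_of_flat_of_dvd [Module.Flat A B] {a b : A} {p : Ideal A}
    (hp : ∀ x, a ∣ x * b → x ∈ p) {y : B} (hy : algebraMap A B a ∣ y * algebraMap A B b) :
    y ∈ p.map (algebraMap A B) := by
  obtain ⟨z, hz⟩ := hy
  -- The equation `b y = a z` is a linear relation over `A`. By flatness it is a combination of
  -- relations in `A`, whose first entries lie in `p`.
  have h : ∑ i : Fin 2, (![b, -a] : Fin 2 → A) i • (![y, z] : Fin 2 → B) i = 0 := by
    simp [Fin.sum_univ_two, Algebra.smul_def]
    linear_combination hz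
  obtain ⟨k, c, t, h1, h2⟩ := Module.Flat.isTrivialRelation_of_sum_smul_eq_zero (R := A) (M := B) h
  have h3 := h1 0
  simp only [Matrix.cons_val_zero] at h3
  rw [h3]
  refine Ideal.sum_mem _ fun j _ => ?_
  rw [Algebra.smul_def]
  refine Ideal.mul_mem_right _ _ (Ideal.mem_map_of_mem _ (hp _ ⟨c 1 j, ?_⟩))
  have := h2 j
  simp [Fin.sum_univ_two] at this
  linear_combination this

/-- A Nakayama argument: if every `x ∈ p` became a nonunit multiple of `c`, then `c` would lie in `𝔪
c`. So some `x ∈ p` generates `pB`, and contracting along the faithfully flat extension gives `p =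
(x)`. -/
theorem Ideal.isPrincipal_of_map_eq_span_singleton [IsDomain B] [IsLocalRing B]
    [Module.FaithfullyFlat A B] {p : Ideal A} {c : B} (hc : c ≠ 0)
    (h : p.map (algebraMap A B) = Ideal.span {c}) : p.IsPrincipal := by
  have h1 : ∃ x ∈ p, ∃ u : B, IsUnit u ∧ algebraMap A B x = c * u := by
    by_contra! h0
    have h2 : p.map (algebraMap A B) ≤ IsLocalRing.maximalIdeal B * Ideal.span {c} := by
      rw [Ideal.map_le_iff_le_comap]
      intro x hx
      have h3 := Ideal.mem_map_of_mem (algebraMap A B) hx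
      rw [h, Ideal.mem_span_singleton] at h3
      obtain ⟨u, hu⟩ := h3
      rw [Ideal.mem_comap, hu, mul_comm c u]
      refine Ideal.mul_mem_mul (?_ : u ∈ _) (Ideal.mem_span_singleton_self c)
      rw [IsLocalRing.mem_maximalIdeal, mem_nonunits_iff]
      exact fun hu' => h0 x hx u hu' hu
    have h3 : c ∈ IsLocalRing.maximalIdeal B * Ideal.span {c} := by
      apply h2
      rw [h]
      exact Ideal.mem_span_singleton_self c
    obtain ⟨z, hz, hzc⟩ := Ideal.mem_mul_span_singleton.mp h3
    have : z = 1 := mul_right_cancel₀ hc (by rw [hzc, one_mul])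
    rw [this] at hz
    exact hz isUnit_one
  obtain ⟨x, hx, u, hu, hxu⟩ := h1
  refine ⟨x, le_antisymm (fun y hy => ?_) ((Ideal.span_singleton_le_iff_mem _).mpr hx)⟩
  have h2 := Ideal.mem_map_of_mem (algebraMap A B) hy
  rw [h, ← Ideal.span_singleton_mul_right_unit hu, ← hxu] at h2
  change y ∈ Ideal.span {x}
  rw [← Ideal.comap_map_eq_self_of_faithfullyFlat (B := B) (Ideal.span {x}), Ideal.map_span,
    Set.image_singleton]
  exact h2

variable (A B) in
/-- A Noetherian domain with a faithfully flat extension which is a factorial local domain is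
factorial. -/
theorem UniqueFactorizationMonoid.of_faithfullyFlat [IsDomain A] [IsNoetherianRing A] [IsDomain B]
    [IsLocalRing B] [UniqueFactorizationMonoid B] [Module.FaithfullyFlat A B] :
    UniqueFactorizationMonoid A := by
  refine UniqueFactorizationMonoid.of_forall_isPrincipal_of_height_eq_one fun p hp hp1 => ?_
  obtain ⟨a, ha, ha0⟩ := Submodule.exists_mem_ne_zero_of_ne_bot (Ideal.ne_bot_of_height_eq_one hp1)
  -- A height-one prime is minimal over any of its nonzero elements `a`. It is thus an associated
  -- prime of `A/(a)`, that is, a colon ideal `(a) : b`.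
  have hmin : p ∈ (Module.annihilator A (A ⧸ Ideal.span {a})).minimalPrimes := by
    rw [Ideal.annihilator_quotient]
    obtain ⟨q, hq, hqp⟩ := Ideal.exists_minimalPrimes_le ((Ideal.span_singleton_le_iff_mem p).mpr ha)
    rcases hqp.lt_or_eq with h | h
    · exfalso
      have := hq.1.1
      have h1 := Ideal.height_add_one_le_of_lt_of_isPrime h
      rw [hp1] at h1
      have h2 : q.height = 0 := by
        have h3 : q.height < 1 := lt_of_lt_of_le (ENat.lt_add_one_iff (ne_top_of_le_ne_top
          ENat.one_ne_top (le_self_add.trans h1)) |>.mpr le_rfl) h1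
        exact Order.lt_one_iff.mp h3
      rw [Ideal.height_eq_zero_iff] at h2
      rw [IsDomain.minimalPrimes_eq_singleton_bot, Set.mem_singleton_iff] at h2
      apply ha0
      rw [← Ideal.mem_bot, ← h2]
      exact hq.1.2 (Ideal.mem_span_singleton_self a)
    · exact h ▸ hq
  obtain ⟨-, x, hx⟩ := isAssociatedPrime_iff.mp
    (Module.associatedPrimes.minimalPrimes_annihilator_subset_associatedPrimes A _ hmin)
  obtain ⟨b, rfl⟩ := Ideal.Quotient.mk_surjective x
  have hpb (x : A) : x ∈ p ↔ a ∣ x * b := by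
    rw [hx, Submodule.mem_colon_singleton, Submodule.mem_bot, ← Ideal.Quotient.mk_eq_mk,
      ← Submodule.Quotient.mk_smul, Submodule.Quotient.mk_eq_zero, smul_eq_mul,
      Ideal.mem_span_singleton]
  have hinj : Function.Injective (algebraMap A B) := FaithfulSMul.algebraMap_injective A B
  have ha0' : algebraMap A B a ≠ 0 := by rwa [Ne, map_eq_zero_iff _ hinj]
  -- Colon ideals commute with flat extension. In the factorial ring `B`, removing the common factor
  -- `c'` of `a` and `b` shows that `(a) : b` is generated by `a'`.
  obtain ⟨a', b', c', hrel, hca, hcb⟩ :=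
    UniqueFactorizationMonoid.exists_reduced_factors (algebraMap A B a) ha0' (algebraMap A B b)
  have hc' : c' ≠ 0 := fun h => ha0' (by rw [← hca, h, zero_mul])
  have ha'0 : a' ≠ 0 := fun h => ha0' (by rw [← hca, h, mul_zero])
  refine Ideal.isPrincipal_of_map_eq_span_singleton (B := B) ha'0 (le_antisymm ?_ ?_)
  · rw [Ideal.map_le_iff_le_comap]
    intro x hx
    rw [Ideal.mem_comap, Ideal.mem_span_singleton]
    have h1 := map_dvd (algebraMap A B) ((hpb x).mp hx)
    rw [map_mul, ← hca, ← hcb, mul_left_comm] at h1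
    exact hrel.dvd_of_dvd_mul_right ((mul_dvd_mul_iff_left hc').mp h1)
  · rw [Ideal.span_singleton_le_iff_mem]
    refine Ideal.mem_map_of_flat_of_dvd (a := a) (b := b) (fun x hx => (hpb x).mpr hx) ⟨b', ?_⟩
    rw [← hca, ← hcb]
    ring

end FactorialDescent

/-! ### Completions of formally étale local algebras -/

section EtaleCompletion

open IsLocalRing

theorem AdicCompletion.factorPow_evalₐ {B : Type*} [CommRing B] (J : Ideal B) {k n : ℕ}
    (hk : k ≤ n) (x : AdicCompletion J B) :
    Ideal.Quotient.factorPow J hk (AdicCompletion.evalₐ J n x) = AdicCompletion.evalₐ J k x := by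
  induction x using AdicCompletion.induction_on with
  | _ x =>
    rw [AdicCompletion.evalₐ_mk, AdicCompletion.evalₐ_mk]
    exact (AdicCompletion.Ideal.mk_eq_mk J hk x)

variable {P A : Type*} [CommRing P] [CommRing A] [Algebra P A] [IsLocalRing A]
  [Algebra.FormallyEtale P A] (I : Ideal P)

/-- A local formally étale algebra without residue field extension has the same completion. -/
theorem AdicCompletion.nonempty_ringEquiv_of_formallyEtale
    (hI : I.map (algebraMap P A) ≤ maximalIdeal A)
    (hbij : Function.Bijective (Ideal.quotientMap (maximalIdeal A) (algebraMap P A)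
      (Ideal.map_le_iff_le_comap.mp hI))) :
    Nonempty (AdicCompletion (maximalIdeal A) A ≃+* AdicCompletion I P) := by
  let m := maximalIdeal A
  let f1 : (P ⧸ I) →ₐ[P] (A ⧸ m) := Ideal.Quotient.liftₐ I (Algebra.ofId P (A ⧸ m)) fun a ha => by
    rw [Algebra.ofId_apply, ← Ideal.Quotient.mk_algebraMap, Ideal.Quotient.eq_zero_iff_mem]
    exact hI (Ideal.mem_map_of_mem _ ha)
  have hf1 : Function.Bijective f1 := hbij
  let e1 := AlgEquiv.ofBijective f1 hf1
  let g1 : A →ₐ[P] P ⧸ I := e1.symm.toAlgHom.comp (Ideal.Quotient.mkₐ P m)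
  -- Formal smoothness lifts `A → A/𝔪 ≅ P/I` to the `I`-adic completion of `P`. Its components `g n`
  -- will invert the structure maps `f n` modulo `n`-th powers.
  obtain ⟨G, hG⟩ := Algebra.FormallySmooth.exists_adicCompletionEvalOneₐ_comp_eq g1
  let g (n : ℕ) : A →ₐ[P] P ⧸ I ^ n := (AdicCompletion.evalₐ I n).comp G
  let f (n : ℕ) : (P ⧸ I ^ n) →ₐ[P] (A ⧸ m ^ n) :=
    Ideal.Quotient.liftₐ (I ^ n) (Algebra.ofId P (A ⧸ m ^ n)) fun a ha => by
      rw [Algebra.ofId_apply, ← Ideal.Quotient.mk_algebraMap, Ideal.Quotient.eq_zero_iff_mem]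
      refine Ideal.pow_right_mono hI n ?_
      rw [← Ideal.map_pow]
      exact Ideal.mem_map_of_mem _ ha
  have hg1 (n : ℕ) (hn : 1 ≤ n) (a : A) (p : P) (h : g n a = Ideal.Quotient.mk _ p) :
      g1 a = Ideal.Quotient.mk I p := by
    have h1 : g1 a = AdicCompletion.evalOneₐ I (G a) := congr($hG a).symm
    have h2 : AdicCompletion.evalₐ I 1 (G a) = Ideal.Quotient.mk _ p := by
      rw [← AdicCompletion.factorPow_evalₐ I hn (G a)]
      exact congr(Ideal.Quotient.factorPow I hn $h)
    rw [h1, ← AdicCompletion.factorₐ_evalₐ_one, h2]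
    rfl
  have hfg (n : ℕ) (hn : 1 ≤ n) (a : A) (p : P) (h : g n a = Ideal.Quotient.mk _ p) :
      algebraMap P A p - a ∈ m := by
    have h1 : f1 (g1 a) = Ideal.Quotient.mk m a := e1.apply_symm_apply _
    rw [hg1 n hn a p h] at h1
    rw [← Ideal.Quotient.eq]
    exact h1
  have hgm (n : ℕ) (x : A) (hx : x ∈ m ^ n) : g n x = 0 := by
    rcases Nat.eq_zero_or_pos n with rfl | hn
    · have : Subsingleton (P ⧸ I ^ 0) := by
        rw [pow_zero]
        exact Ideal.Quotient.subsingleton_iff.mpr Ideal.one_eq_top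
      exact Subsingleton.elim _ _
    have h1 : m ≤ (I.map (Ideal.Quotient.mk (I ^ n))).comap (g n) := by
      intro y hy
      obtain ⟨p, hp⟩ := Ideal.Quotient.mk_surjective (g n y)
      have h2 := hg1 n hn y p hp.symm
      have h3 : g1 y = 0 := by
        change e1.symm (Ideal.Quotient.mk m y) = 0
        rw [Ideal.Quotient.eq_zero_iff_mem.mpr hy]
        exact e1.symm.map_zero
      rw [Ideal.mem_comap, ← hp]
      refine Ideal.mem_map_of_mem _ ?_
      rwa [← Ideal.Quotient.eq_zero_iff_mem, ← h2]
    have h2 := Ideal.le_comap_pow (g n) n ((Ideal.pow_right_mono h1 n) hx)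
    rw [Ideal.mem_comap, ← Ideal.map_pow, Ideal.map_quotient_self, Ideal.mem_bot] at h2
    exact h2
  let gb (n : ℕ) : (A ⧸ m ^ n) →ₐ[P] (P ⧸ I ^ n) := Ideal.Quotient.liftₐ (m ^ n) (g n) (hgm n)
  have hgbf (n : ℕ) (x : P ⧸ I ^ n) : gb n (f n x) = x := by
    obtain ⟨p, rfl⟩ := Ideal.Quotient.mk_surjective x
    exact (g n).commutes p
  have hfgb (n : ℕ) (x : A ⧸ m ^ n) : f n (gb n x) = x := by
    obtain ⟨a, rfl⟩ := Ideal.Quotient.mk_surjective x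
    rcases Nat.eq_zero_or_pos n with rfl | hn
    · have : Subsingleton (A ⧸ m ^ 0) := by
        rw [pow_zero]
        exact Ideal.Quotient.subsingleton_iff.mpr Ideal.one_eq_top
      exact Subsingleton.elim _ _
    -- Both maps agree modulo the nilpotent ideal `𝔪/𝔪ⁿ`, so they coincide by formal unramifiedness.
    have h1 : (f n).comp (g n) = Ideal.Quotient.mkₐ P (m ^ n) := by
      refine Algebra.FormallyUnramified.ext (I := m.map (Ideal.Quotient.mk (m ^ n))) ⟨n, ?_⟩
        fun a => ?_
      · rw [← Ideal.map_pow, Ideal.map_quotient_self, Ideal.zero_eq_bot]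
      · obtain ⟨p, hp⟩ := Ideal.Quotient.mk_surjective (g n a)
        rw [Ideal.Quotient.eq, AlgHom.comp_apply, ← hp]
        change Ideal.Quotient.mk (m ^ n) (algebraMap P A p) - Ideal.Quotient.mk (m ^ n) a ∈ _
        rw [← map_sub]
        exact Ideal.mem_map_of_mem _ (hfg n hn a p hp.symm)
    exact congr($h1 a)
  have hgf {k n : ℕ} (hk : k ≤ n) (x : P ⧸ I ^ n) : Ideal.Quotient.factorPow m hk (f n x) =
      f k (Ideal.Quotient.factorPow I hk x) := by
    obtain ⟨p, rfl⟩ := Ideal.Quotient.mk_surjective x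
    rfl
  let Ψ := AdicCompletion.liftRingHom m
    (fun n => (f n : _ →+* _).comp (AdicCompletion.evalₐ I n : AdicCompletion I P →+* P ⧸ I ^ n))
    (fun {k n} hk => RingHom.ext fun x => by
      simp only [RingHom.comp_apply, RingHom.coe_coe]
      rw [hgf hk, AdicCompletion.factorPow_evalₐ])
  let Φ := AdicCompletion.liftRingHom I
    (fun n => (gb n : _ →+* _).comp (AdicCompletion.evalₐ m n : AdicCompletion m A →+* A ⧸ m ^ n))
    (fun {k n} hk => RingHom.ext fun x => by
      simp only [RingHom.comp_apply, RingHom.coe_coe]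
      change _ = gb k (AdicCompletion.evalₐ m k x)
      rw [← AdicCompletion.factorPow_evalₐ m hk x]
      apply (Function.LeftInverse.injective (hgbf k))
      rw [← hgf hk, hfgb, hfgb])
  have hΨ (n : ℕ) (x) : AdicCompletion.evalₐ m n (Ψ x) = f n (AdicCompletion.evalₐ I n x) :=
    AdicCompletion.evalₐ_liftRingHom _ _ _ _ _
  have hΦ (n : ℕ) (x) : AdicCompletion.evalₐ I n (Φ x) = gb n (AdicCompletion.evalₐ m n x) :=
    AdicCompletion.evalₐ_liftRingHom _ _ _ _ _
  exact ⟨RingEquiv.ofRingHom Φ Ψ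
    (RingHom.ext fun x => AdicCompletion.ext_evalₐ fun n =>
      (hΦ n (Ψ x)).trans ((congrArg (gb n) (hΨ n x)).trans (hgbf n _)))
    (RingHom.ext fun x => AdicCompletion.ext_evalₐ fun n =>
      (hΨ n (Φ x)).trans ((congrArg (f n) (hΦ n x)).trans (hfgb n _)))⟩

end EtaleCompletion

/-! ### Local rings of smooth algebras are factorial -/

section SmoothFactorial

open IsLocalRing

variable {k : Type*} [Field k] {n : ℕ} {A : Type*} [CommRing A] [IsDomain A]
  [IsNoetherianRing A] [IsLocalRing A]

/-- The completion of `A` is a power series ring over `k`, hence factorial, and it is faithfully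
flat over `A`. -/
theorem UniqueFactorizationMonoid.of_formallyEtale_of_map_X_mem [Infinite k]
    (φ : MvPolynomial (Fin n) k →+* A) (hφ : φ.FormallyEtale)
    (hX : ∀ i, φ (MvPolynomial.X i) ∈ maximalIdeal A)
    (hres : ∀ a, ∃ c : k, φ (MvPolynomial.C c) - a ∈ maximalIdeal A) :
    UniqueFactorizationMonoid A := by
  algebraize [φ]
  let I := MvPolynomial.idealOfVars (Fin n) k
  have : I.IsMaximal := MvPolynomial.isMaximal_idealOfVars k _
  have hI : I.map (algebraMap (MvPolynomial (Fin n) k) A) ≤ maximalIdeal A := by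
    rw [Ideal.map_le_iff_le_comap]
    refine Ideal.span_le.mpr ?_
    rintro _ ⟨i, rfl⟩
    exact hX i
  obtain ⟨e⟩ := AdicCompletion.nonempty_ringEquiv_of_formallyEtale I hI (by
    let _ := Ideal.Quotient.field I
    have : Nontrivial (A ⧸ maximalIdeal A) :=
      Ideal.Quotient.nontrivial_iff.mpr (maximalIdeal.isMaximal A).ne_top
    refine ⟨RingHom.injective _, fun x => ?_⟩
    obtain ⟨a, rfl⟩ := Ideal.Quotient.mk_surjective x
    obtain ⟨c, hc⟩ := hres a
    exact ⟨Ideal.Quotient.mk _ (MvPolynomial.C c), Ideal.Quotient.eq.mpr hc⟩)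
  let e' : MvPowerSeries (Fin n) k ≃+* AdicCompletion (maximalIdeal A) A :=
    (MvPowerSeries.toAdicCompletionAlgEquiv (Fin n) k).toRingEquiv.trans e.symm
  have hdom : IsDomain (MvPowerSeries (Fin n) k) := NoZeroDivisors.to_isDomain _
  have : IsDomain (AdicCompletion (maximalIdeal A) A) := e'.symm.toMulEquiv.isDomain _
  have : UniqueFactorizationMonoid (AdicCompletion (maximalIdeal A) A) :=
    e'.toMulEquiv.uniqueFactorizationMonoid (MvPowerSeries.uniqueFactorizationMonoid_fin k n)
  have : Module.FaithfullyFlat A (AdicCompletion (maximalIdeal A) A) :=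
    Module.FaithfullyFlat.of_flat_of_isLocalHom
  exact UniqueFactorizationMonoid.of_faithfullyFlat A (AdicCompletion (maximalIdeal A) A)

/-- A local domain which is formally étale over a polynomial ring, with residue field the field of
coefficients, is factorial. -/
theorem UniqueFactorizationMonoid.of_formallyEtale [Infinite k]
    (φ : MvPolynomial (Fin n) k →+* A) (hφ : φ.FormallyEtale)
    (hres : ∀ a, ∃ c : k, φ (MvPolynomial.C c) - a ∈ maximalIdeal A) :
    UniqueFactorizationMonoid A := by
  choose c hc using fun i => hres (φ (MvPolynomial.X i))
  -- Translating by the residues `c i` moves the point to the origin, so that the variables land in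
  -- the maximal ideal.
  let τ (d : Fin n → k) : MvPolynomial (Fin n) k →ₐ[k] MvPolynomial (Fin n) k :=
    MvPolynomial.aeval fun i => MvPolynomial.X i + MvPolynomial.C (d i)
  have hτ (d : Fin n → k) : (τ d).comp (τ (-d)) = AlgHom.id k _ := by
    ext1 i
    simp [τ]
  have hbij : Function.Bijective (τ (-c)) :=
    ⟨Function.LeftInverse.injective (g := τ c) fun x => congr($(hτ c) x),
      Function.RightInverse.surjective (g := τ c) fun x => by
        have := congr($(hτ (-c)) x)
        rwa [neg_neg] at this⟩
  refine UniqueFactorizationMonoid.of_formallyEtale_of_map_X_mem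
    (φ.comp (τ (-c)).toRingHom) (RingHom.FormallyEtale.comp (RingHom.Etale.of_bijective hbij).formallyEtale hφ)
    (fun i => ?_) (fun a => ?_)
  · have := neg_mem (hc i)
    simpa [τ, sub_eq_add_neg, add_comm] using this
  · obtain ⟨b, hb⟩ := hres a
    exact ⟨b, by simpa [τ] using hb⟩

/-- The local rings of a smooth algebra over an algebraically closed field are factorial. -/
theorem Algebra.Smooth.uniqueFactorizationMonoid_localization {k S : Type*} [Field k]
    [IsAlgClosed k] [CommRing S] [IsDomain S] [Algebra k S] [Algebra.Smooth k S]
    (p : Ideal S) [p.IsPrime] (A : Type*) [CommRing A] [Algebra S A]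
    [IsLocalization.AtPrime A p] :
    UniqueFactorizationMonoid A := by
  -- At a maximal ideal the residue field is `k` by the Nullstellensatz, so étale coordinates apply
  -- there. The ring `A` is a further localization of `S_m`.
  obtain ⟨m, hm, hpm⟩ := Ideal.exists_le_maximal p ‹p.IsPrime›.ne_top
  have hft : Algebra.FiniteType k S := inferInstance
  have : IsNoetherianRing S := Algebra.FiniteType.isNoetherianRing k S
  let B := Localization.AtPrime m
  have hB : UniqueFactorizationMonoid B := by
    obtain ⟨f, hfm, d, halg, htow, het⟩ :=
      Algebra.IsSmoothAt.exists_isStandardEtale_mvPolynomial (R := k) (p := m)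
    let _ : Algebra (Localization.Away f) B := (IsLocalization.Away.lift (S := Localization.Away f) f
      (g := algebraMap S B) (IsLocalization.map_units B (⟨f, hfm⟩ : m.primeCompl))).toAlgebra
    have : IsScalarTower S (Localization.Away f) B := IsScalarTower.of_algebraMap_eq fun s =>
      (IsLocalization.Away.lift_eq f _ s).symm
    have h1 : Algebra.FormallyEtale S (Localization.Away f) :=
      Algebra.FormallyEtale.of_isLocalization (Submonoid.powers f)
    have h2 : Algebra.FormallyEtale S B := Algebra.FormallyEtale.of_isLocalization m.primeCompl
    have h3 : Algebra.FormallyEtale (Localization.Away f) B :=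
      Algebra.FormallyEtale.of_restrictScalars (R := S)
    have h4 : Algebra.FormallyEtale (MvPolynomial (Fin d) k) (Localization.Away f) := inferInstance
    have hinf : Infinite k := IsAlgClosed.instInfinite
    refine UniqueFactorizationMonoid.of_formallyEtale ((algebraMap (Localization.Away f) B).comp
      (algebraMap (MvPolynomial (Fin d) k) (Localization.Away f)))
      (RingHom.FormallyEtale.comp (RingHom.formallyEtale_algebraMap.mpr h4)
        (RingHom.formallyEtale_algebraMap.mpr h3)) fun a => ?_
    let _ := Ideal.Quotient.field m
    have : Module.Finite k (S ⧸ m) := finite_of_finite_type_of_isJacobsonRing k (S ⧸ m)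
    obtain ⟨x, hx⟩ := (IsLocalization.AtPrime.equivQuotMaximalIdeal m B).surjective
      (Ideal.Quotient.mk _ a)
    obtain ⟨c, rfl⟩ := (IsAlgClosed.algebraMap_bijective_of_isIntegral (k := k) (K := S ⧸ m)).2 x
    refine ⟨c, ?_⟩
    rw [← Ideal.Quotient.eq, ← hx]
    rw [← MvPolynomial.algebraMap_eq, RingHom.comp_apply,
      ← IsScalarTower.algebraMap_apply k, IsScalarTower.algebraMap_apply k S,
      ← IsScalarTower.algebraMap_apply S]
    rfl
  have hle : m.primeCompl ≤ p.primeCompl := fun x hx hxp => hx (hpm hxp)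
  let _ : Algebra B A := (IsLocalization.lift (M := m.primeCompl) (S := B) (g := algebraMap S A)
    fun y => IsLocalization.map_units A (⟨y, hle y.2⟩ : p.primeCompl)).toAlgebra
  have : IsScalarTower S B A := IsScalarTower.of_algebraMap_eq fun s =>
    (IsLocalization.lift_eq _ s).symm
  have := IsLocalization.isLocalization_of_submonoid_le B A m.primeCompl p.primeCompl hle
  exact UniqueFactorizationMonoid.of_isLocalization (p.primeCompl.map (algebraMap S B)) A

end SmoothFactorial

end

noncomputable section

/-! ### Points of codimension one and prime ideals of stalks -/

namespace AlgebraicGeometry.Scheme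

universe u

/-- The stalks of an integral scheme which is smooth over an algebraically closed field are
factorial. -/
theorem uniqueFactorizationMonoid_stalk_of_smooth {k : Type u} [Field k] [IsAlgClosed k]
    {X : Scheme.{u}} [IsIntegral X] (f : X ⟶ Spec (CommRingCat.of k)) [Smooth f] (x : X) :
    UniqueFactorizationMonoid (X.presheaf.stalk x) := by
  obtain ⟨U, hU, hxU, -⟩ := exists_isAffineOpen_mem_and_subset (x := x) (U := ⊤) trivial
  have : Nonempty U := ⟨⟨x, hxU⟩⟩
  have h1 := Scheme.Hom.smooth_appLE f (isAffineOpen_top (Spec (CommRingCat.of k))) hU le_top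
  let φ : k →+* Γ(X, U) :=
    (f.appLE ⊤ U le_top).hom.comp (Scheme.ΓSpecIso (CommRingCat.of k)).inv.hom
  have h2 : φ.Smooth := by
    refine RingHom.Smooth.comp ?_ h1
    exact RingHom.Smooth.of_bijective (ConcreteCategory.bijective_of_isIso (Scheme.ΓSpecIso (CommRingCat.of k)).inv)
  algebraize [φ]
  have h3 := hU.isLocalization_stalk ⟨x, hxU⟩
  let _ := X.presheaf.algebra_section_stalk (⟨x, hxU⟩ : U)
  exact Algebra.Smooth.uniqueFactorizationMonoid_localization (k := k)
    (hU.primeIdealOf ⟨x, hxU⟩).asIdeal (X.presheaf.stalk x)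

variable {X : Scheme.{u}}

/-- The prime ideal of the local ring at `y` corresponding to a generisation of `y`. -/
def primeOfSpecializes {P y : X} (h : P ⤳ y) : Ideal (X.presheaf.stalk y) :=
  (IsLocalRing.maximalIdeal (X.presheaf.stalk P)).comap (X.presheaf.stalkSpecializes h).hom

instance {P y : X} (h : P ⤳ y) : (primeOfSpecializes h).IsPrime :=
  Ideal.comap_isPrime _ _

theorem fromSpecStalk_primeOfSpecializes {P y : X} (h : P ⤳ y) :
    X.fromSpecStalk y ⟨primeOfSpecializes h, inferInstance⟩ = P := by
  have h1 := SpecMap_stalkSpecializes_fromSpecStalk h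
  have h2 := congr($h1 (IsLocalRing.closedPoint (X.presheaf.stalk P)))
  rw [fromSpecStalk_closedPoint] at h2
  exact h2

theorem specializes_of_primeOfSpecializes_le {P Q y : X} {h : P ⤳ y} {h' : Q ⤳ y}
    (hle : primeOfSpecializes h ≤ primeOfSpecializes h') : P ⤳ Q := by
  rw [← fromSpecStalk_primeOfSpecializes h, ← fromSpecStalk_primeOfSpecializes h']
  refine Specializes.map ?_ (X.fromSpecStalk y).continuous
  exact (PrimeSpectrum.le_iff_specializes _ _).mp hle

theorem fromSpecStalk_specializes {y : X} (q : Spec (X.presheaf.stalk y)) :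
    X.fromSpecStalk y q ⤳ y := by
  have : X.fromSpecStalk y q ∈ Set.range (X.fromSpecStalk y) := ⟨q, rfl⟩
  rwa [range_fromSpecStalk] at this

theorem primeOfSpecializes_fromSpecStalk {y : X} (q : Spec (X.presheaf.stalk y)) :
    primeOfSpecializes (fromSpecStalk_specializes q) = q.asIdeal := by
  have := (X.fromSpecStalk y).isEmbedding.injective
    (fromSpecStalk_primeOfSpecializes (fromSpecStalk_specializes q))
  exact congr(PrimeSpectrum.asIdeal $this)

/-- The spectrum of the stalk at `y` is order-isomorphic to the set of generisations of `y`, and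
this set is closed under generisation. So prime divisors through `y` correspond to height-one primes
of the stalk. -/
theorem height_primeOfSpecializes {P y : X} (h : P ⤳ y) :
    (primeOfSpecializes h).height = Order.coheight P := by
  let q : Spec (X.presheaf.stalk y) := ⟨primeOfSpecializes h, inferInstance⟩
  have h1 := idealHeight_eq_coheight (X.presheaf.stalk y) q
  refine h1.trans ?_
  have hemb := (X.fromSpecStalk y).isEmbedding.isInducing
  rw [Order.coheight_eq_of_strictMono (X.fromSpecStalk y) ?_ ?_ q]
  · rw [fromSpecStalk_primeOfSpecializes]
  · intro a b hab
    rw [lt_iff_le_not_ge] at hab ⊢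
    exact ⟨hemb.specializes_iff.mpr hab.1, fun h => hab.2 (hemb.specializes_iff.mp h)⟩
  · intro a b hab
    have hb : b ∈ Set.range (X.fromSpecStalk y) := by
      rw [range_fromSpecStalk]
      exact Specializes.trans hab.le (fromSpecStalk_specializes a)
    obtain ⟨a', rfl⟩ := hb
    rw [lt_iff_le_not_ge] at hab
    refine ⟨a', ?_, rfl⟩
    rw [lt_iff_le_not_ge]
    exact ⟨hemb.specializes_iff.mp hab.1, fun h => hab.2 (hemb.specializes_iff.mpr h)⟩

theorem notMem_primeOfSpecializes_iff {P y : X} (h : P ⤳ y) (a : X.presheaf.stalk y) :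
    a ∉ primeOfSpecializes h ↔ IsUnit (X.presheaf.stalkSpecializes h a) := by
  rw [primeOfSpecializes, Ideal.mem_comap, IsLocalRing.notMem_maximalIdeal]

variable [IsIntegral X]

theorem algebraMap_stalkSpecializes {P y : X} (h : P ⤳ y) (a : X.presheaf.stalk y) :
    algebraMap (X.presheaf.stalk P) X.functionField (X.presheaf.stalkSpecializes h a) =
      algebraMap (X.presheaf.stalk y) X.functionField a := by
  simp only [RingHom.algebraMap_toAlgebra]
  rw [← ConcreteCategory.comp_apply, TopCat.Presheaf.stalkSpecializes_comp]

theorem stalkSpecializes_ne_zero {P y : X} (h : P ⤳ y) {a : X.presheaf.stalk y} (ha : a ≠ 0) :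
    X.presheaf.stalkSpecializes h a ≠ 0 := by
  intro h0
  have := algebraMap_stalkSpecializes h a
  rw [h0, map_zero] at this
  exact ha (by simpa using this.symm)

/-- Local sections representing `f` agree on overlaps, because these are nonempty and sections embed
into the function field. So they glue. -/
theorem mem_range_germToFunctionField {U : X.Opens} [Nonempty U] {f : X.functionField}
    (h : ∀ y ∈ U, f ∈ (algebraMap (X.presheaf.stalk y) X.functionField).range) :
    f ∈ (X.germToFunctionField U).hom.range := by
  choose g hg using h
  have hex : ∀ y : U, ∃ (V : X.Opens) (_ : y.1 ∈ V) (_ : V ≤ U) (s : Γ(X, V)) (_ : Nonempty V),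
      X.germToFunctionField V s = f := by
    intro y
    obtain ⟨V, hyV, s, hs⟩ := X.presheaf.exists_germ_eq (g y.1 y.2)
    have : Nonempty ((V ⊓ U : X.Opens)) := ⟨⟨y.1, hyV, y.2⟩⟩
    refine ⟨V ⊓ U, ⟨hyV, y.2⟩, inf_le_right, X.presheaf.map (homOfLE inf_le_left).op s, this, ?_⟩
    have hy : y.1 ∈ V ⊓ U := ⟨hyV, y.2⟩
    rw [← algebraMap_germ_eq_germToFunctionField X hy, X.presheaf.germ_res_apply, hs, hg]
  choose V hyV hVU s hne hs using hex
  have hcompat : TopCat.Presheaf.IsCompatible X.sheaf.1 V s := by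
    intro i j
    have : Nonempty ((V i ⊓ V j : X.Opens)) := by
      obtain ⟨z, hz⟩ := nonempty_preirreducible_inter (V i).2 (V j).2
        ⟨i.1, hyV i⟩ ⟨j.1, hyV j⟩
      exact ⟨⟨z, hz⟩⟩
    apply X.germToFunctionField_injective (V i ⊓ V j)
    have h1 := X.presheaf.germ_res_apply (Opens.infLELeft (V i) (V j)) (genericPoint X)
      (((genericPoint_spec X).mem_open_set_iff (V i ⊓ V j).isOpen).mpr (by simpa using this)) (s i)
    have h2 := X.presheaf.germ_res_apply (Opens.infLERight (V i) (V j)) (genericPoint X)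
      (((genericPoint_spec X).mem_open_set_iff (V i ⊓ V j).isOpen).mpr (by simpa using this)) (s j)
    exact h1.trans ((hs i).trans ((hs j).symm.trans h2.symm))
  obtain ⟨t, ht, -⟩ := X.sheaf.existsUnique_gluing' V U (fun i => homOfLE (hVU i))
    (fun y hy => Opens.mem_iSup.mpr ⟨⟨y, hy⟩, hyV ⟨y, hy⟩⟩) s hcompat
  refine ⟨t, ?_⟩
  obtain ⟨y⟩ := ‹Nonempty U›
  have h1 := X.presheaf.germ_res_apply (homOfLE (hVU y)) (genericPoint X)
      (((genericPoint_spec X).mem_open_set_iff (V y).isOpen).mpr (by simpa using hne y)) t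
  refine h1.symm.trans ?_
  have := ht y
  exact (congrArg _ this).trans (hs y)

variable [IsLocallyNoetherian X]

theorem isDiscreteValuationRing_stalk {P : X} [UniqueFactorizationMonoid (X.presheaf.stalk P)]
    (hP : Order.coheight P = 1) : IsDiscreteValuationRing (X.presheaf.stalk P) := by
  have h1 : (IsLocalRing.maximalIdeal (X.presheaf.stalk P)).height = 1 := by
    have := ringKrullDim_stalk_eq_coheight P
    rw [hP, ← IsLocalRing.maximalIdeal_height_eq_ringKrullDim] at this
    exact_mod_cast this
  have h2 : ¬ IsField (X.presheaf.stalk P) := by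
    rw [IsLocalRing.isField_iff_maximalIdeal_eq]
    exact Ideal.ne_bot_of_height_eq_one h1
  exact ((IsDiscreteValuationRing.TFAE _ h2).out 0 4).mpr
    (UniqueFactorizationMonoid.isPrincipal_of_height_eq_one h1)

end AlgebraicGeometry.Scheme

end

noncomputable section

/-! ### Orders of rational functions along prime divisors -/

namespace AlgebraicGeometry.Scheme

universe u

variable {X : Scheme.{u}} [IsIntegral X] [IsLocallyNoetherian X]

@[simp]
theorem ord_one (P : X) : ord (1 : X.functionField) P = 0 := by
  have := ord_mul (x := P) (one_ne_zero' X.functionField) (one_ne_zero' X.functionField)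
  simpa using this

theorem ord_inv {f : X.functionField} (hf : f ≠ 0) (P : X) : ord f⁻¹ P = - ord f P := by
  have := ord_mul (x := P) hf (inv_ne_zero hf)
  rw [mul_inv_cancel₀ hf, ord_one] at this
  linarith

theorem ord_pow {f : X.functionField} (hf : f ≠ 0) (m : ℕ) (P : X) :
    ord (f ^ m) P = m * ord f P := by
  induction m with
  | zero => simp
  | succ m ih =>
    rw [pow_succ, ord_mul (pow_ne_zero _ hf) hf, ih]
    push_cast
    ring

theorem ord_zpow {f : X.functionField} (hf : f ≠ 0) (m : ℤ) (P : X) :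
    ord (f ^ m) P = m * ord f P := by
  obtain ⟨k, rfl | rfl⟩ := m.eq_nat_or_neg
  · rw [zpow_natCast, ord_pow hf]
  · rw [zpow_neg, zpow_natCast, ord_inv (pow_ne_zero _ hf), ord_pow hf]
    simp

theorem ord_prod {ι : Type*} (s : Finset ι) {f : ι → X.functionField} (hf : ∀ i ∈ s, f i ≠ 0)
    (P : X) : ord (∏ i ∈ s, f i) P = ∑ i ∈ s, ord (f i) P := by
  classical
  induction s using Finset.induction_on with
  | empty => simp
  | insert a s ha ih =>
    rw [Finset.prod_insert ha, Finset.sum_insert ha, ord_mul, ih]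
    · exact fun i hi => hf i (Finset.mem_insert_of_mem hi)
    · exact hf a (Finset.mem_insert_self _ _)
    · exact Finset.prod_ne_zero_iff.mpr fun i hi => hf i (Finset.mem_insert_of_mem hi)

theorem ord_algebraMap_nonneg {P : X} (a : X.presheaf.stalk P) :
    0 ≤ ord (algebraMap (X.presheaf.stalk P) X.functionField a) P := by
  by_cases hP : Order.coheight P = 1
  swap
  · simp [hP]
  by_cases ha : a = 0
  · simp [ha]
  have : Ring.KrullDimLE 1 (X.presheaf.stalk P) := krullDimLE_of_coheight_le hP.le
  rw [le_ord_iff hP (by simpa using ha)]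
  exact Ring.ordFrac_ge_one_of_ne_zero ha

theorem ord_algebraMap_of_isUnit {P : X} {a : X.presheaf.stalk P} (ha : IsUnit a) :
    ord (algebraMap (X.presheaf.stalk P) X.functionField a) P = 0 := by
  by_cases hP : Order.coheight P = 1
  swap
  · simp [hP]
  have : Ring.KrullDimLE 1 (X.presheaf.stalk P) := krullDimLE_of_coheight_le hP.le
  rw [ord_eq_iff hP (by simpa using ha.ne_zero)]
  exact Ring.ordFrac_of_isUnit ha

theorem ord_algebraMap_of_irreducible {P : X} [UniqueFactorizationMonoid (X.presheaf.stalk P)]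
    (hP : Order.coheight P = 1) {a : X.presheaf.stalk P} (ha : Irreducible a) :
    ord (algebraMap (X.presheaf.stalk P) X.functionField a) P = 1 := by
  have := isDiscreteValuationRing_stalk hP
  rw [ord_eq_iff hP (by simpa using ha.ne_zero)]
  exact Ring.ordFrac_irreducible ha

theorem isUnit_of_ord_algebraMap_eq_zero {P : X} [UniqueFactorizationMonoid (X.presheaf.stalk P)]
    (hP : Order.coheight P = 1) {a : X.presheaf.stalk P} (ha : a ≠ 0)
    (h : ord (algebraMap (X.presheaf.stalk P) X.functionField a) P = 0) : IsUnit a := by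
  have := isDiscreteValuationRing_stalk hP
  rw [ord_eq_iff hP (by simpa using ha)] at h
  exact Ring.isUnit_iff_ordFrac_one_of_isDiscreteValuationRing.mpr h

/-- For `h = a/b`, the prime of such a `P` has height one and contains `ab`, so it is one of the
finitely many minimal primes over `(ab)`. -/
theorem finite_setOf_ord_ne_zero {U : X.Opens} (hU : IsAffineOpen U) {h : X.functionField}
    (hh : h ≠ 0) : {P : X | P ∈ U ∧ ord h P ≠ 0}.Finite := by
  rcases (U : Set X).eq_empty_or_nonempty with he | hne
  · refine Set.Finite.subset Set.finite_empty fun P hP => ?_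
    rw [← he]
    exact hP.1
  have : Nonempty U := hne.to_subtype
  have := functionField_isFractionRing_of_isAffineOpen X U hU
  have : IsNoetherianRing Γ(X, U) := IsLocallyNoetherian.component_noetherian ⟨U, hU⟩
  obtain ⟨a, b, hb, rfl⟩ := IsFractionRing.div_surjective (A := Γ(X, U)) h
  have hb0 : b ≠ 0 := nonZeroDivisors.ne_zero hb
  have ha0 : a ≠ 0 := by
    rintro rfl
    simp at hh
  have hfin := Ideal.finite_minimalPrimes_of_isNoetherianRing Γ(X, U) (Ideal.span {a * b})
  refine Set.Finite.subset ((hfin.preimage (f := PrimeSpectrum.asIdeal)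
    (fun _ _ _ _ => PrimeSpectrum.ext)).image hU.fromSpec) ?_
  rintro P ⟨hPU, hP⟩
  refine ⟨hU.primeIdealOf ⟨P, hPU⟩, ?_, hU.fromSpec_primeIdealOf ⟨P, hPU⟩⟩
  have hc : Order.coheight P = 1 := by
    by_contra hc
    exact hP (ord_eq_zero_of_coheight_neq_one hc _)
  have hloc := hU.isLocalization_stalk ⟨P, hPU⟩
  let _ := X.presheaf.algebra_section_stalk (⟨P, hPU⟩ : U)
  have hht : (hU.primeIdealOf ⟨P, hPU⟩).asIdeal.height = 1 := by
    have h1 := IsLocalization.AtPrime.ringKrullDim_eq_height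
      (hU.primeIdealOf ⟨P, hPU⟩).asIdeal (X.presheaf.stalk P)
    rw [ringKrullDim_stalk_eq_coheight P, hc] at h1
    exact_mod_cast h1.symm
  have hfh : (hU.primeIdealOf ⟨P, hPU⟩).asIdeal.FiniteHeight := by
    simp [Ideal.finiteHeight_iff, hht]
  refine Ideal.mem_minimalPrimes_of_height_le ?_ ?_
  · rw [Ideal.span_singleton_le_iff_mem]
    by_contra hmem
    apply hP
    have hu : IsUnit (X.presheaf.germ U P hPU (a * b)) :=
      IsLocalization.map_units (X.presheaf.stalk P)
        (⟨a * b, hmem⟩ : (hU.primeIdealOf ⟨P, hPU⟩).asIdeal.primeCompl)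
    rw [map_mul, IsUnit.mul_iff] at hu
    have ha := ord_algebraMap_of_isUnit hu.1
    have hb := ord_algebraMap_of_isUnit hu.2
    rw [algebraMap_germ_eq_germToFunctionField] at ha hb
    have hb0' : algebraMap Γ(X, U) X.functionField b ≠ 0 := by simpa using hb0
    have ha0' : algebraMap Γ(X, U) X.functionField a ≠ 0 := by simpa using ha0
    rw [div_eq_mul_inv, ord_mul ha0' (inv_ne_zero hb0'), ord_inv hb0']
    erw [ha, hb]
    simp
  · rw [hht]
    exact Ideal.one_le_height_span_singleton_of_mem_nonZeroDivisors
      (mem_nonZeroDivisors_of_ne_zero (mul_ne_zero ha0 hb0))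

variable [∀ x : X, UniqueFactorizationMonoid (X.presheaf.stalk x)]

/-- On a locally factorial scheme, a rational function without poles is regular. -/
theorem mem_range_algebraMap_stalk_of_ord_nonneg {y : X} {f : X.functionField}
    (h : ∀ P : X, Order.coheight P = 1 → P ⤳ y → 0 ≤ ord f P) :
    f ∈ (algebraMap (X.presheaf.stalk y) X.functionField).range := by
  by_cases hf : f = 0
  · exact hf ▸ zero_mem _
  obtain ⟨a, b, hab, rfl⟩ := IsFractionRing.exists_reduced_fraction (X.presheaf.stalk y) f
  have hb0 : (b : X.presheaf.stalk y) ≠ 0 := nonZeroDivisors.coe_ne_zero b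
  by_cases hb : IsUnit (b : X.presheaf.stalk y)
  · obtain ⟨c, hc⟩ := hb
    refine ⟨a * (c⁻¹ : (X.presheaf.stalk y)ˣ), ?_⟩
    rw [IsLocalization.eq_mk'_iff_mul_eq, ← map_mul, mul_assoc, ← hc, Units.inv_mul, mul_one]
  exfalso
  -- A prime factor of a nonunit denominator does not divide the numerator, so `f` has a pole along
  -- the divisor that it defines.
  obtain ⟨π, hπ, hπb⟩ := WfDvdMonoid.exists_irreducible_factor hb hb0
  have hπ' : Prime π := hπ.prime
  have hπa : ¬ π ∣ a := fun h' => hπ.not_isUnit (hab h' hπb)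
  let q : Spec (X.presheaf.stalk y) :=
    ⟨Ideal.span {π}, (Ideal.span_singleton_prime hπ.ne_zero).mpr hπ'⟩
  have hPy := fromSpecStalk_specializes q
  have hq : primeOfSpecializes hPy = Ideal.span {π} := primeOfSpecializes_fromSpecStalk q
  have hP : Order.coheight (X.fromSpecStalk y q) = 1 := by
    rw [← height_primeOfSpecializes hPy, hq]
    exact Ideal.height_span_singleton_eq_one_of_mem_nonZeroDivisors
      (mem_nonZeroDivisors_of_ne_zero hπ.ne_zero) hπ.not_isUnit
  have ha0 : a ≠ 0 := fun h0 => hπa (h0 ▸ dvd_zero π)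
  have h1 := h _ hP hPy
  have h2 : ord (algebraMap (X.presheaf.stalk y) X.functionField a) (X.fromSpecStalk y q) = 0 := by
    rw [← algebraMap_stalkSpecializes hPy]
    apply ord_algebraMap_of_isUnit
    rw [← notMem_primeOfSpecializes_iff, hq, Ideal.mem_span_singleton]
    exact hπa
  have h3 : ord (algebraMap (X.presheaf.stalk y) X.functionField b) (X.fromSpecStalk y q) ≠ 0 := by
    rw [← algebraMap_stalkSpecializes hPy]
    intro h0
    have := isUnit_of_ord_algebraMap_eq_zero hP (stalkSpecializes_ne_zero hPy hb0) h0
    rw [← notMem_primeOfSpecializes_iff, hq, Ideal.mem_span_singleton] at this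
    exact this hπb
  have h4 : 0 ≤ ord (algebraMap (X.presheaf.stalk y) X.functionField b) (X.fromSpecStalk y q) := by
    rw [← algebraMap_stalkSpecializes hPy]
    exact ord_algebraMap_nonneg _
  have h5 := ord_mul (x := X.fromSpecStalk y q) hf
    (show algebraMap (X.presheaf.stalk y) X.functionField b ≠ 0 by simp)
  rw [IsLocalization.mk'_spec, h2] at h5
  omega

/-- On a locally factorial scheme, prime divisors are principal near every point. -/
theorem exists_ord_eq_one_and_ord_eq_zero {P y : X} (hP : Order.coheight P = 1) (h : P ⤳ y) :
    ∃ u : X.functionField, u ≠ 0 ∧ ord u P = 1 ∧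
      ∀ Q : X, Order.coheight Q = 1 → Q ⤳ y → Q ≠ P → ord u Q = 0 := by
  have hht : (primeOfSpecializes h).height = 1 := by rw [height_primeOfSpecializes, hP]
  obtain ⟨π, hπ⟩ := (UniqueFactorizationMonoid.isPrincipal_of_height_eq_one hht).principal
  rw [Ideal.submodule_span_eq] at hπ
  have hπ0 : π ≠ 0 := by
    rintro rfl
    exact Ideal.ne_bot_of_height_eq_one hht (by simpa using hπ)
  refine ⟨algebraMap (X.presheaf.stalk y) X.functionField π, by simpa using hπ0, ?_, ?_⟩
  · rw [← algebraMap_stalkSpecializes h]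
    have hdvr := isDiscreteValuationRing_stalk hP
    apply ord_algebraMap_of_irreducible hP
    rw [IsDiscreteValuationRing.irreducible_iff_uniformizer]
    apply le_antisymm
    -- Up to a unit, `c` is the image of a section near `y` vanishing along `P`, which is a multiple
    -- of `π` already in the stalk at `y`.
    · intro c hc
      obtain ⟨U, hU, hyU, -⟩ := exists_isAffineOpen_mem_and_subset (x := y) (U := ⊤) trivial
      have hPU : P ∈ U := h.mem_open U.isOpen hyU
      have hloc := hU.isLocalization_stalk ⟨P, hPU⟩
      let _ := X.presheaf.algebra_section_stalk (⟨P, hPU⟩ : U)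
      obtain ⟨⟨s, t⟩, hst⟩ := IsLocalization.surj (hU.primeIdealOf ⟨P, hPU⟩).asIdeal.primeCompl c
      have ht : IsUnit (algebraMap Γ(X, U) (X.presheaf.stalk P) t) :=
        IsLocalization.map_units (X.presheaf.stalk P) t
      have hs : X.presheaf.stalkSpecializes h (X.presheaf.germ U y hyU s) =
          algebraMap Γ(X, U) (X.presheaf.stalk P) s :=
        TopCat.Presheaf.germ_stalkSpecializes_apply X.presheaf hyU h s
      have hmem : X.presheaf.germ U y hyU s ∈ primeOfSpecializes h := by
        rw [primeOfSpecializes, Ideal.mem_comap]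
        change X.presheaf.stalkSpecializes h (X.presheaf.germ U y hyU s) ∈ _
        rw [hs, ← hst]
        exact Ideal.mul_mem_right _ _ hc
      rw [hπ, Ideal.mem_span_singleton] at hmem
      rw [Ideal.mem_span_singleton]
      have := map_dvd (X.presheaf.stalkSpecializes h).hom hmem
      change _ ∣ X.presheaf.stalkSpecializes h (X.presheaf.germ U y hyU s) at this
      rw [hs] at this
      exact ht.dvd_mul_right.mp (hst ▸ this)
    · rw [Ideal.span_singleton_le_iff_mem]
      change π ∈ primeOfSpecializes h
      exact hπ ▸ Ideal.mem_span_singleton_self π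
  · intro Q hQ hQy hQP
    rw [← algebraMap_stalkSpecializes hQy]
    apply ord_algebraMap_of_isUnit
    rw [← notMem_primeOfSpecializes_iff]
    intro hmem
    have hle : primeOfSpecializes h ≤ primeOfSpecializes hQy := by
      rw [hπ, Ideal.span_singleton_le_iff_mem]
      exact hmem
    have hle' : primeOfSpecializes hQy ≤ primeOfSpecializes h := by
      have : (primeOfSpecializes hQy).height = 1 := by rw [height_primeOfSpecializes, hQ]
      have hfin : (primeOfSpecializes h).FiniteHeight := by
        simp [Ideal.finiteHeight_iff, hht]
      exact (Ideal.eq_of_le_of_height_le _ hle (this.trans hht.symm).le).ge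
    exact hQP ((specializes_of_primeOfSpecializes_le hle').antisymm
      (specializes_of_primeOfSpecializes_le hle)).eq

end AlgebraicGeometry.Scheme

end

noncomputable section

namespace GConstellation

/-! ### Characters of a finite abelian group -/

section Characters

variable (G : Type*) [CommGroup G]

instance finite_monoidHom_units_complex [Finite G] : Finite (G →* ℂˣ) :=
  have : NeZero (Monoid.exponent G) := ⟨Monoid.exponent_ne_zero_of_finite⟩
  have e := (CommGroup.monoidHom_mulEquiv_of_hasEnoughRootsOfUnity G ℂ).some
  Finite.of_equiv G e.symm.toEquiv

instance fintype_monoidHom_units_complex [Finite G] : Fintype (G →* ℂˣ) := Fintype.ofFinite _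

variable {G}

theorem sum_character_apply_eq_zero [Finite G] {g : G} (hg : g ≠ 1) :
    ∑ χ : G →* ℂˣ, ((χ g : ℂˣ) : ℂ) = 0 := by
  have : NeZero (Monoid.exponent G) := ⟨Monoid.exponent_ne_zero_of_finite⟩
  obtain ⟨ψ, hψ⟩ := CommGroup.exists_apply_ne_one_of_hasEnoughRootsOfUnity G ℂ hg
  have h : ((ψ g : ℂˣ) : ℂ) * ∑ χ : G →* ℂˣ, ((χ g : ℂˣ) : ℂ) =
      ∑ χ : G →* ℂˣ, ((χ g : ℂˣ) : ℂ) := by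
    rw [Finset.mul_sum, ← Equiv.sum_comp (Equiv.mulLeft ψ) (fun χ : G →* ℂˣ => ((χ g : ℂˣ) : ℂ))]
    simp
  by_contra h0
  apply hψ
  ext
  simpa [h0] using h

theorem card_characters [Finite G] : Fintype.card (G →* ℂˣ) = Nat.card G := by
  have : NeZero (Monoid.exponent G) := ⟨Monoid.exponent_ne_zero_of_finite⟩
  rw [← Nat.card_eq_fintype_card]
  exact CommGroup.card_monoidHom_of_hasEnoughRootsOfUnity G ℂ

end Characters

/-! ### Weight decomposition of the field of rational functions -/

section Weights

variable {G : Type*} [CommGroup G] {n : ℕ} {w : Fin n → (G →* ℂˣ)}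

theorem act_apply (g : G) (f : CoordRing n) : act w g f = actHom w g f := rfl

theorem act_mul (g h : G) (f : CoordRing n) : act w (g * h) f = act w g (act w h f) := by
  simp only [act_apply, ← actHom_comp, AlgHom.comp_apply]

theorem act_X (g : G) (i : Fin n) :
    act w g (MvPolynomial.X i) = ((w i g⁻¹ : ℂˣ) : ℂ) • MvPolynomial.X i := by
  simp only [act_apply, actHom, MvPolynomial.aeval_X, MvPolynomial.smul_eq_C_mul]

theorem actK_algebraMap (g : G) (f : CoordRing n) :
    actK w g (algebraMap (CoordRing n) (RatFun n) f) =
      algebraMap (CoordRing n) (RatFun n) (act w g f) :=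
  IsFractionRing.ringEquivOfRingEquiv_algebraMap _ _

theorem actK_mul (g h : G) (f : RatFun n) : actK w (g * h) f = actK w g (actK w h f) := by
  obtain ⟨a, b, -, rfl⟩ := IsFractionRing.div_surjective (A := CoordRing n) f
  simp only [map_div₀, actK_algebraMap, act_mul]

theorem actK_one (f : RatFun n) : actK w 1 f = f := by
  obtain ⟨a, b, -, rfl⟩ := IsFractionRing.div_surjective (A := CoordRing n) f
  simp only [map_div₀, actK_algebraMap, act_apply, actHom_one, AlgHom.id_apply]

theorem hasWeight_X (i : Fin n) :
    HasWeight w (w i) (algebraMap (CoordRing n) (RatFun n) (MvPolynomial.X i)) := by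
  intro g
  rw [actK_algebraMap, act_X, Algebra.smul_def, map_mul, Algebra.smul_def,
    ← IsScalarTower.algebraMap_apply]

theorem hasWeight_algebraMap (c : ℂ) : HasWeight w 1 (algebraMap ℂ (RatFun n) c) := fun g => by
  simp

namespace HasWeight

variable {χ ψ : G →* ℂˣ} {f f' : RatFun n}

theorem mul (h : HasWeight w χ f) (h' : HasWeight w ψ f') : HasWeight w (χ * ψ) (f * f') := by
  intro g
  rw [map_mul, h g, h' g, MonoidHom.mul_apply, Units.val_mul, smul_mul_smul_comm]

theorem inv (h : HasWeight w χ f) : HasWeight w χ⁻¹ f⁻¹ := by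
  intro g
  rw [map_inv₀, h g, MonoidHom.inv_apply, Units.val_inv_eq_inv_val, Algebra.smul_def, Algebra.smul_def,
    mul_inv, map_inv₀]

theorem div (h : HasWeight w χ f) (h' : HasWeight w ψ f') : HasWeight w (χ / ψ) (f / f') := by
  rw [show f / f' = f * f'⁻¹ from div_eq_mul_inv _ _]
  exact h.mul h'.inv

theorem zero : HasWeight w χ 0 := fun g => by simp

theorem add (h : HasWeight w χ f) (h' : HasWeight w χ f') : HasWeight w χ (f + f') := by
  intro g
  rw [map_add, h g, h' g, smul_add]

theorem one_mul (h : HasWeight w 1 f) (h' : HasWeight w χ f') : HasWeight w χ (f * f') := by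
  rw [← _root_.one_mul χ]
  exact h.mul h'

theorem smul (c : ℂ) (h : HasWeight w χ f) : HasWeight w χ (c • f) := by
  rw [Algebra.smul_def]
  exact (hasWeight_algebraMap c).one_mul h

theorem actK_eq (h : HasWeight w 1 f) (g : G) : actK w g f = f := by
  simpa using h g

theorem eq_of_ne_zero (h : HasWeight w χ f) (h' : HasWeight w ψ f) (hf : f ≠ 0) : χ = ψ := by
  ext g
  have := (h g⁻¹).symm.trans (h' g⁻¹)
  simpa using smul_left_injective ℂ hf this

theorem pow_card [Finite G] (h : HasWeight w χ f) : HasWeight w 1 (f ^ Nat.card G) := by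
  intro g
  rw [map_pow, h g, Algebra.smul_def, mul_pow, ← map_pow, ← Units.val_pow_eq_pow_val, ← map_pow,
    pow_card_eq_one']
  simp

end HasWeight

variable [Fintype G]

/-- `|G|` times the projection onto the functions of weight `χ`. -/
def weightProj (w : Fin n → (G →* ℂˣ)) (χ : G →* ℂˣ) : RatFun n →ₗ[ℂ] RatFun n :=
  ∑ g : G, ((χ g : ℂˣ) : ℂ) • (actK w g).toLinearMap

theorem weightProj_apply (χ : G →* ℂˣ) (s : RatFun n) :
    weightProj w χ s = ∑ g : G, ((χ g : ℂˣ) : ℂ) • actK w g s := by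
  simp [weightProj]

theorem hasWeight_weightProj (χ : G →* ℂˣ) (s : RatFun n) :
    HasWeight w χ (weightProj w χ s) := by
  intro h
  rw [weightProj_apply, map_sum, Finset.smul_sum, ← Equiv.sum_comp (Equiv.mulLeft h) (fun g => ((χ h⁻¹ : ℂˣ) : ℂ) • ((χ g : ℂˣ) : ℂ) • actK w g s)]
  refine Finset.sum_congr rfl fun g _ => ?_
  rw [Equiv.coe_mulLeft, smul_smul, ← Units.val_mul, ← map_mul, inv_mul_cancel_left, actK_mul,
    Algebra.smul_def, Algebra.smul_def, map_mul, AlgEquiv.commutes]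

theorem weightProj_of_hasWeight {χ : G →* ℂˣ} {s : RatFun n} (h : HasWeight w χ s) :
    weightProj w χ s = (Nat.card G : ℂ) • s := by
  rw [weightProj_apply, Finset.sum_congr rfl (g := fun _ => s)]
  · simp [Algebra.smul_def]
  · intro g _
    rw [h g, smul_smul, ← Units.val_mul, ← map_mul]
    simp

theorem weightProj_of_hasWeight_of_ne {χ ψ : G →* ℂˣ} (hne : χ ≠ ψ) {s : RatFun n}
    (h : HasWeight w ψ s) : weightProj w χ s = 0 := by
  have : weightProj w χ s = (∑ g : G, ((χ g : ℂˣ) : ℂ) * ((ψ g⁻¹ : ℂˣ) : ℂ)) • s := by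
    rw [weightProj_apply, Finset.sum_smul]
    refine Finset.sum_congr rfl fun g _ => ?_
    rw [h g, smul_smul]
  by_contra h0
  exact hne ((hasWeight_weightProj χ s).eq_of_ne_zero (this ▸ h.smul _) h0)

theorem sum_weightProj (s : RatFun n) :
    ∑ χ : G →* ℂˣ, weightProj w χ s = (Nat.card G : ℂ) • s := by
  classical
  simp only [weightProj_apply]
  rw [Finset.sum_comm]
  simp only [← Finset.sum_smul]
  rw [Finset.sum_eq_single 1]
  · simp [actK_one, card_characters]
  · intro g _ hg
    rw [sum_character_apply_eq_zero hg, zero_smul]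
  · simp

theorem weightProj_actK (χ : G →* ℂˣ) (g : G) (s : RatFun n) :
    weightProj w χ (actK w g s) = ((χ g⁻¹ : ℂˣ) : ℂ) • weightProj w χ s := by
  rw [← hasWeight_weightProj χ s g, weightProj_apply, weightProj_apply, map_sum]
  refine Finset.sum_congr rfl fun h _ => ?_
  rw [Algebra.smul_def, Algebra.smul_def, map_mul, AlgEquiv.commutes, ← actK_mul, ← actK_mul,
    mul_comm g]

theorem weightProj_mul {a : RatFun n} (ha : HasWeight w 1 a) (χ : G →* ℂˣ) (s : RatFun n) :
    weightProj w χ (a * s) = a * weightProj w χ s := by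
  simp only [weightProj_apply, map_mul, ha.actK_eq, Finset.mul_sum, mul_smul_comm]

/-- Otherwise the projection `∑ χ(g) g` vanishes on `K(ℂⁿ)`. Faithfulness makes the automorphisms
`g` distinct, so this contradicts Dedekind's linear independence. -/
theorem exists_ne_zero_hasWeight (hw : IsFaithful w) (χ : G →* ℂˣ) :
    ∃ f : RatFun n, f ≠ 0 ∧ HasWeight w χ f := by
  by_contra! hcon
  have h0 : ∀ s, weightProj w χ s = 0 := fun s => by
    by_contra h
    exact hcon _ h (hasWeight_weightProj χ s)
  let φ : G → (RatFun n →* RatFun n) := fun g => ((actK w g : RatFun n →+* RatFun n) : _ →* _)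
  have hφ : Function.Injective φ := by
    intro g h hgh
    rw [← mul_inv_eq_one]
    refine hw _ fun i => ?_
    have h1 : actK w g (algebraMap (CoordRing n) (RatFun n) (MvPolynomial.X i)) =
      actK w h (algebraMap (CoordRing n) (RatFun n) (MvPolynomial.X i)) := DFunLike.congr_fun hgh _
    have h2 := h1.symm.trans (hasWeight_X i g)
    rw [hasWeight_X i h] at h2
    have h3 := smul_left_injective ℂ (by simp : algebraMap (CoordRing n) (RatFun n)
      (MvPolynomial.X i) ≠ 0) h2
    have h4 : w i h = w i g := by simpa [Units.ext_iff] using h3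
    rw [map_mul, map_inv, h4, mul_inv_cancel]
  have hli := (linearIndependent_monoidHom (RatFun n) (RatFun n)).comp φ hφ
  have := Fintype.linearIndependent_iff.mp hli
    (fun g => algebraMap ℂ (RatFun n) ((χ g : ℂˣ) : ℂ)) (by
      ext s
      simpa [weightProj_apply, Algebra.smul_def, φ] using h0 s) 1
  -- The coefficient at `g = 1` is `χ(1) = 1`.
  simp at this

end Weights

/-! ### The function field of `Y` as the field of invariants -/

namespace Resolution

variable {G : Type*} [CommGroup G] {n : ℕ} {w : Fin n → (G →* ℂˣ)} (Y : Resolution w)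

theorem hasWeight_toRatFun (h : Y.Y.functionField) : HasWeight w 1 (Y.toRatFun h) := by
  have hinv : ∀ a : invariants w, HasWeight w 1 (algebraMap (CoordRing n) (RatFun n) a) := by
    intro a g
    rw [actK_algebraMap, a.2 g]
    simp
  let _ : Algebra (invariants w) Y.Y.functionField := Y.pullbackInv.toAlgebra
  have _ : IsFractionRing (invariants w) Y.Y.functionField := Y.isFractionRing_pullbackInv
  obtain ⟨a, b, -, rfl⟩ := IsFractionRing.div_surjective (A := invariants w) h
  rw [map_div₀]
  have h1 : ∀ a, Y.toRatFun (algebraMap (invariants w) Y.Y.functionField a) =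
    algebraMap (CoordRing n) (RatFun n) a := Y.toRatFun_pullbackInv
  rw [h1, h1]
  exact (div_self' (1 : G →* ℂˣ)) ▸ (hinv a).div (hinv b)

theorem mem_range_toRatFun [Fintype G] {f : RatFun n} (hf : HasWeight w 1 f) :
    ∃ h, Y.toRatFun h = f := by
  classical
  obtain ⟨a, b, hb, rfl⟩ := IsFractionRing.div_surjective (A := CoordRing n) f
  have hb0 : b ≠ 0 := nonZeroDivisors.ne_zero hb
  -- Multiplying by the other conjugates of `b` turns the denominator into its norm, which is
  -- invariant. The numerator is then invariant as well.
  let c : CoordRing n := ∏ g ∈ Finset.univ.erase (1 : G), act w g b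
  have hbc : b * c = ∏ g : G, act w g b := by
    rw [← Finset.mul_prod_erase _ _ (Finset.mem_univ (1 : G))]
    simp [c, act_apply, actHom_one]
  have hc0 : c ≠ 0 := Finset.prod_ne_zero_iff.mpr fun g _ => by simpa using hb0
  have hinv : ∀ g, act w g (b * c) = b * c := by
    intro g
    rw [hbc, map_prod, ← Equiv.prod_comp (Equiv.mulLeft g) (fun h => act w h b)]
    simp [act_mul]
  have hfrac : algebraMap (CoordRing n) (RatFun n) a / algebraMap (CoordRing n) (RatFun n) b =
      algebraMap (CoordRing n) (RatFun n) (a * c) /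
        algebraMap (CoordRing n) (RatFun n) (b * c) := by
    rw [map_mul, map_mul, mul_div_mul_right _ _ (by simpa using hc0)]
  have hinv' : ∀ g, act w g (a * c) = a * c := by
    intro g
    apply IsFractionRing.injective (CoordRing n) (RatFun n)
    have h1 := hf.actK_eq g
    rw [hfrac, map_div₀, actK_algebraMap, actK_algebraMap, hinv,
      div_left_inj' (by simpa using ⟨hb0, hc0⟩)] at h1
    exact h1
  refine ⟨Y.pullbackInv ⟨a * c, hinv'⟩ / Y.pullbackInv ⟨b * c, hinv⟩, ?_⟩
  rw [map_div₀, toRatFun_pullbackInv, toRatFun_pullbackInv, hfrac]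

theorem toRatFun_injective : Function.Injective Y.toRatFun := Y.toRatFun.injective

theorem val_eq_of_toRatFun_eq [Finite G] {h : Y.Y.functionField} {f : RatFun n}
    (hf : Y.toRatFun h = f ^ Nat.card G) (P : Y.PrimeDivisor) :
    Y.val P f = (Scheme.ord h P.1 : ℚ) / Nat.card G := by
  rw [val, ← hf, Function.leftInverse_invFun Y.toRatFun_injective]

theorem val_toRatFun [Finite G] {h : Y.Y.functionField} (hh : h ≠ 0) (P : Y.PrimeDivisor) :
    Y.val P (Y.toRatFun h) = Scheme.ord h P.1 := by
  have hG : (Nat.card G : ℚ) ≠ 0 := Nat.cast_ne_zero.mpr Nat.card_pos.ne'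
  rw [Y.val_eq_of_toRatFun_eq (h := h ^ Nat.card G) (map_pow _ _ _), Scheme.ord_pow hh]
  push_cast
  field_simp

theorem val_mul [Fintype G] {χ ψ : G →* ℂˣ} {f f' : RatFun n} (hf : HasWeight w χ f)
    (hf' : HasWeight w ψ f') (h0 : f ≠ 0) (h0' : f' ≠ 0) (P : Y.PrimeDivisor) :
    Y.val P (f * f') = Y.val P f + Y.val P f' := by
  obtain ⟨h, hh⟩ := Y.mem_range_toRatFun hf.pow_card
  obtain ⟨h', hh'⟩ := Y.mem_range_toRatFun hf'.pow_card
  have hne : h ≠ 0 := by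
    rintro rfl
    exact pow_ne_zero _ h0 (by rw [← hh, map_zero])
  have hne' : h' ≠ 0 := by
    rintro rfl
    exact pow_ne_zero _ h0' (by rw [← hh', map_zero])
  rw [Y.val_eq_of_toRatFun_eq hh, Y.val_eq_of_toRatFun_eq hh',
    Y.val_eq_of_toRatFun_eq (h := h * h') (by rw [map_mul, hh, hh', mul_pow]),
    Scheme.ord_mul hne hne']
  push_cast
  ring

end Resolution

end GConstellation

end

noncomputable section

namespace GConstellation

/-! ### Local equations and the sheaves `𝓛(-D)` -/

namespace Resolution

variable {G : Type*} [CommGroup G] {n : ℕ} {w : Fin n → (G →* ℂˣ)} (Y : Resolution w)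

instance uniqueFactorizationMonoid_stalk (y : Y.Y) :
    UniqueFactorizationMonoid (Y.Y.presheaf.stalk y) :=
  haveI := Y.smooth
  Scheme.uniqueFactorizationMonoid_stalk_of_smooth (Y.π ≫ quotToC w) y

variable {Y}

theorem regular_le_localRing {U : Y.Y.Opens} [Nonempty U] {y : Y.Y} (hy : y ∈ U) :
    Y.regular U ≤ Y.localRing y := by
  rintro _ ⟨a, rfl⟩
  refine ⟨Y.Y.presheaf.germ U y hy a, ?_⟩
  simp only [RingHom.comp_apply]
  congr 1
  exact Scheme.algebraMap_germ_eq_germToFunctionField Y.Y hy a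

theorem hasWeight_of_mem_localRing {y : Y.Y} {f : RatFun n} (hf : f ∈ Y.localRing y) :
    HasWeight w 1 f := by
  obtain ⟨a, rfl⟩ := hf
  exact Y.hasWeight_toRatFun _

theorem hasWeight_of_mem_regular {U : Y.Y.Opens} [Nonempty U] {f : RatFun n}
    (hf : f ∈ Y.regular U) : HasWeight w 1 f := by
  obtain ⟨a, rfl⟩ := hf
  exact Y.hasWeight_toRatFun _

theorem mem_regular_of_forall_mem_localRing {U : Y.Y.Opens} [Nonempty U] {f : RatFun n}
    (h : ∀ y ∈ U, f ∈ Y.localRing y) : f ∈ Y.regular U := by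
  obtain ⟨y⟩ := ‹Nonempty U›
  obtain ⟨b, hb⟩ := h y.1 y.2
  obtain ⟨a, ha⟩ := Scheme.mem_range_germToFunctionField (U := U)
    (f := algebraMap (Y.Y.presheaf.stalk y.1) Y.Y.functionField b) fun z hz => by
      obtain ⟨c, hc⟩ := h z hz
      exact ⟨c, Y.toRatFun_injective (hc.trans hb.symm)⟩
  refine ⟨a, ?_⟩
  rw [RingHom.comp_apply, ha]
  exact hb

theorem val_nonneg_of_mem_localRing [Finite G] {P : Y.PrimeDivisor} {f : RatFun n}
    (hf : f ∈ Y.localRing P.1) (h0 : f ≠ 0) : 0 ≤ Y.val P f := by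
  obtain ⟨a, rfl⟩ := hf
  rw [RingHom.comp_apply] at h0 ⊢
  rw [Y.val_toRatFun ((map_ne_zero _).mp h0)]
  exact_mod_cast Scheme.ord_algebraMap_nonneg a

section

variable [Fintype G]

theorem mem_localRing_of_val_nonneg {y : Y.Y} {f : RatFun n} (hf : HasWeight w 1 f) (h0 : f ≠ 0)
    (h : ∀ P : Y.PrimeDivisor, P.1 ⤳ y → 0 ≤ Y.val P f) : f ∈ Y.localRing y := by
  obtain ⟨k, rfl⟩ := Y.mem_range_toRatFun hf
  have hk : k ≠ 0 := (map_ne_zero _).mp h0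
  obtain ⟨a, ha⟩ := Scheme.mem_range_algebraMap_stalk_of_ord_nonneg (y := y) (f := k)
    fun P hP hPy => by
      have := (h ⟨P, hP⟩ hPy).trans_eq (Y.val_toRatFun hk ⟨P, hP⟩)
      exact_mod_cast this
  exact ⟨a, by rw [RingHom.comp_apply, ha]⟩

theorem val_div {χ ψ : G →* ℂˣ} {f f' : RatFun n} (hf : HasWeight w χ f)
    (hf' : HasWeight w ψ f') (h0 : f ≠ 0) (h0' : f' ≠ 0) (P : Y.PrimeDivisor) :
    Y.val P (f / f') = Y.val P f - Y.val P f' := by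
  have := Y.val_mul (hf.div hf') hf' (div_ne_zero h0 h0') h0' P
  rw [div_mul_cancel₀ _ h0'] at this
  linarith

theorem finite_setOf_val_ne {χ : G →* ℂˣ} {f : RatFun n} (hf : HasWeight w χ f) (h0 : f ≠ 0)
    (D : Y.PrimeDivisor →₀ ℚ) {U : Y.Y.Opens} (hU : IsAffineOpen U) :
    {P : Y.PrimeDivisor | P.1 ∈ U ∧ Y.val P f ≠ D P}.Finite := by
  obtain ⟨h, hh⟩ := Y.mem_range_toRatFun hf.pow_card
  have hne : h ≠ 0 := by
    rintro rfl
    exact pow_ne_zero _ h0 (by rw [← hh, map_zero])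
  refine Set.Finite.subset ((D.support.finite_toSet).union
    ((Scheme.finite_setOf_ord_ne_zero hU hne).preimage
      (Subtype.val_injective.injOn (s := Subtype.val ⁻¹' _)))) ?_
  rintro P ⟨hPU, hP⟩
  by_cases hD : D P = 0
  · refine Or.inr ⟨hPU, fun h1 => hP ?_⟩
    rw [Y.val_eq_of_toRatFun_eq hh, h1, hD]
    simp
  · exact Or.inl (by simpa using hD)

/-- In an affine neighbourhood only finitely many prime divisors violate the equation. None passes
through `y`, so their closures can be removed. -/
theorem exists_isLocalEquation_of_forall_specializes {χ : G →* ℂˣ} {D : Y.PrimeDivisor →₀ ℚ}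
    {y : Y.Y} {e : RatFun n} (he : HasWeight w χ e) (h0 : e ≠ 0)
    (h : ∀ P : Y.PrimeDivisor, P.1 ⤳ y → Y.val P e = D P) :
    ∃ V : Y.Y.Opens, y ∈ V ∧ Y.IsLocalEquation χ D V e := by
  obtain ⟨U, hU, hyU, -⟩ := exists_isAffineOpen_mem_and_subset (x := y) (U := ⊤) trivial
  have hT := finite_setOf_val_ne he h0 D hU
  have hcl : IsClosed (⋃ P ∈ {P : Y.PrimeDivisor | P.1 ∈ U ∧ Y.val P e ≠ D P},
      closure ({P.1} : Set Y.Y)) := hT.isClosed_biUnion fun _ _ => isClosed_closure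
  refine ⟨U ⊓ ⟨_, hcl.isOpen_compl⟩, ⟨hyU, ?_⟩, h0, he, fun P hP => ?_⟩
  · intro hy
    obtain ⟨P, hP, hPy⟩ := Set.mem_iUnion₂.mp hy
    exact hP.2 (h P (specializes_iff_mem_closure.mpr hPy))
  · by_contra hne
    exact hP.2 (Set.mem_iUnion₂.mpr ⟨P, ⟨hP.1, hne⟩, subset_closure rfl⟩)

/-- For any nonzero `f` of weight `χ` the difference `D - (f)` has integral coefficients `E P`.
Multiplying `f` by local equations of the prime divisors through `y`, raised to these powers,
corrects it near `y`. -/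
theorem exists_isLocalEquation (hw : IsFaithful w) {χ : G →* ℂˣ} {D : Y.PrimeDivisor →₀ ℚ}
    (hD : Y.IsWeilDivisor χ D) (y : Y.Y) :
    ∃ (V : Y.Y.Opens) (e : RatFun n), y ∈ V ∧ Y.IsLocalEquation χ D V e := by
  classical
  obtain ⟨f, h0, hf⟩ := exists_ne_zero_hasWeight hw χ
  have hE : ∀ P : Y.PrimeDivisor, ∃ k : ℤ, D P = Y.val P f + k := by
    intro P
    obtain ⟨k, hk⟩ := hD P f h0 hf
    -- The floor appears because `IsWeilDivisor` compares `D P` with the fractional part of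
    -- `v_P(f)`.
    refine ⟨k - ⌊Y.val P f⌋, ?_⟩
    have := Int.fract_add_floor (Y.val P f)
    push_cast
    linarith
  choose E hE using hE
  obtain ⟨U, hU, hyU, -⟩ := exists_isAffineOpen_mem_and_subset (x := y) (U := ⊤) trivial
  let S := (finite_setOf_val_ne hf h0 D hU).toFinset.filter fun P => P.1 ⤳ y
  have hu : ∀ P : Y.PrimeDivisor, ∃ u : Y.Y.functionField, u ≠ 0 ∧ (P.1 ⤳ y →
      ∀ Q : Y.PrimeDivisor, Q.1 ⤳ y → Scheme.ord u Q.1 = if Q = P then 1 else 0) := by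
    intro P
    by_cases hP : P.1 ⤳ y
    · obtain ⟨u, hu0, hu1, hu2⟩ := Scheme.exists_ord_eq_one_and_ord_eq_zero P.2 hP
      refine ⟨u, hu0, fun _ Q hQ => ?_⟩
      split_ifs with hQP
      · rw [hQP, hu1]
      · exact hu2 Q.1 Q.2 hQ fun h => hQP (Subtype.ext h)
    · exact ⟨1, one_ne_zero, fun h => absurd h hP⟩
  choose u hu0 hu using hu
  have hprod : ∏ P ∈ S, u P ^ E P ≠ 0 :=
    Finset.prod_ne_zero_iff.mpr fun P _ => zpow_ne_zero _ (hu0 P)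
  have h1 := Y.hasWeight_toRatFun (∏ P ∈ S, u P ^ E P)
  have h10 : Y.toRatFun (∏ P ∈ S, u P ^ E P) ≠ 0 := (map_ne_zero _).mpr hprod
  obtain ⟨V, hyV, hV⟩ := exists_isLocalEquation_of_forall_specializes (D := D) (y := y)
    (h1.one_mul hf) (mul_ne_zero h10 h0) fun Q hQ => by
      rw [Y.val_mul h1 hf h10 h0, Y.val_toRatFun hprod,
        Scheme.ord_prod _ fun P _ => zpow_ne_zero _ (hu0 P), hE Q, add_comm, add_right_inj,
        Int.cast_inj]
      rw [Finset.sum_congr rfl (g := fun P => if Q = P then E P else 0)]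
      · rw [Finset.sum_ite_eq, ite_eq_left_iff]
        intro hQS
        have hQU : Q.1 ∈ U := hQ.mem_open U.isOpen hyU
        have hval : Y.val Q f = D Q := by
          by_contra hne
          exact hQS (Finset.mem_filter.mpr ⟨by simpa using ⟨hQU, hne⟩, hQ⟩)
        have := hE Q
        rw [hval] at this
        have h0 : (E Q : ℚ) = 0 := by linarith
        exact_mod_cast h0.symm
      · intro P hP
        rw [Scheme.ord_zpow (hu0 P), hu P (Finset.mem_filter.mp hP).2 Q hQ]
        simp
  exact ⟨V, _, hyV, hV⟩

theorem exists_forall_isLocalEquation (hw : IsFaithful w)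
    {D : (G →* ℂˣ) → (Y.PrimeDivisor →₀ ℚ)} (hD : Y.IsPrereductorSet D) (y : Y.Y) :
    ∃ (V : Y.Y.Opens) (e : (G →* ℂˣ) → RatFun n), y ∈ V ∧
      ∀ χ, Y.IsLocalEquation χ (D χ) V (e χ) := by
  choose V e hyV he using fun χ => exists_isLocalEquation hw (hD χ) y
  refine ⟨⟨⋂ χ, V χ, isOpen_iInter_of_finite fun χ => (V χ).isOpen⟩, e,
    Set.mem_iInter.mpr hyV, fun χ => ⟨(he χ).1, (he χ).2.1, fun P hP => (he χ).2.2 P ?_⟩⟩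
  exact Set.mem_iInter.mp hP χ

end

theorem IsLocalEquation.mono {χ : G →* ℂˣ} {D : Y.PrimeDivisor →₀ ℚ} {U V : Y.Y.Opens}
    {e : RatFun n} (he : Y.IsLocalEquation χ D U e) (hVU : V ≤ U) : Y.IsLocalEquation χ D V e :=
  ⟨he.1, he.2.1, fun P hP => he.2.2 P (hVU hP)⟩

theorem lineSheaf_mono {χ : G →* ℂˣ} {D : Y.PrimeDivisor →₀ ℚ} {U V : Y.Y.Opens} [Nonempty U]
    [Nonempty V] (hVU : V ≤ U) {s : RatFun n} (hs : s ∈ Y.lineSheaf χ D U) :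
    s ∈ Y.lineSheaf χ D V := by
  intro y hy
  obtain ⟨W, _, hyW, -, hsW⟩ := hs y (hVU hy)
  have : Nonempty ((W ⊓ V : Y.Y.Opens)) := ⟨⟨y, hyW, hy⟩⟩
  exact ⟨W ⊓ V, this, ⟨hyW, hy⟩, inf_le_right, Y.span_localEquation_mono χ D inf_le_left hsW⟩

theorem mem_lineSheaf_of_locally {χ : G →* ℂˣ} {D : Y.PrimeDivisor →₀ ℚ} {U : Y.Y.Opens}
    [Nonempty U] {s : RatFun n}
    (h : ∀ y ∈ U, ∃ (V : Y.Y.Opens) (_ : Nonempty V), y ∈ V ∧ V ≤ U ∧ s ∈ Y.lineSheaf χ D V) :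
    s ∈ Y.lineSheaf χ D U := by
  intro y hy
  obtain ⟨V, _, hyV, hVU, hs⟩ := h y hy
  obtain ⟨W, hW, hyW, hWV, hsW⟩ := hs y hyV
  exact ⟨W, hW, hyW, hWV.trans hVU, hsW⟩

theorem hasWeight_of_mem_lineSheaf {χ : G →* ℂˣ} {D : Y.PrimeDivisor →₀ ℚ} {U : Y.Y.Opens}
    [Nonempty U] {s : RatFun n} (hs : s ∈ Y.lineSheaf χ D U) : HasWeight w χ s := by
  obtain ⟨y⟩ := ‹Nonempty U›
  replace hs := hs y.1 y.2
  obtain ⟨V, _, -, -, hs⟩ := hs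
  induction hs using Submodule.span_induction with
  | mem f hf => exact hf.2.1
  | zero => exact HasWeight.zero
  | add x y _ _ hx hy => exact hx.add hy
  | smul a x _ hx => exact (hasWeight_of_mem_regular a.2).one_mul hx

theorem IsLocalEquation.mul_mem_lineSheaf {χ : G →* ℂˣ} {D : Y.PrimeDivisor →₀ ℚ} {U : Y.Y.Opens}
    [Nonempty U] {e a : RatFun n} (he : Y.IsLocalEquation χ D U e) (ha : a ∈ Y.regular U) :
    a * e ∈ Y.lineSheaf χ D U := fun _ hy =>
  ⟨U, inferInstance, hy, le_rfl,
    Submodule.smul_mem _ (⟨a, ha⟩ : Y.regular U) (Submodule.subset_span he)⟩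

theorem IsLocalEquation.mem_lineSheaf {χ : G →* ℂˣ} {D : Y.PrimeDivisor →₀ ℚ} {U : Y.Y.Opens}
    [Nonempty U] {e : RatFun n} (he : Y.IsLocalEquation χ D U e) : e ∈ Y.lineSheaf χ D U := by
  simpa using he.mul_mem_lineSheaf (one_mem _)

section

variable [Fintype G]

/-- The quotient of two local equations is invariant of order zero along every prime divisor through
a point where both are valid, hence regular there. So a local equation on `U` generates `𝓛(-D)` over
`U`. -/
theorem IsLocalEquation.div_mem_regular {χ : G →* ℂˣ} {D : Y.PrimeDivisor →₀ ℚ} {U : Y.Y.Opens}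
    [Nonempty U] {e s : RatFun n} (he : Y.IsLocalEquation χ D U e) (hs : s ∈ Y.lineSheaf χ D U) :
    s / e ∈ Y.regular U := by
  refine mem_regular_of_forall_mem_localRing fun y hy => ?_
  replace hs := hs y hy
  obtain ⟨V, _, hyV, hVU, hs⟩ := hs
  induction hs using Submodule.span_induction with
  | mem f hf =>
    refine mem_localRing_of_val_nonneg (div_self' χ ▸ hf.2.1.div he.2.1)
      (div_ne_zero hf.1 he.1) fun P hP => ?_
    have hPV := hP.mem_open V.isOpen hyV
    rw [val_div hf.2.1 he.2.1 hf.1 he.1, hf.2.2 P hPV, he.2.2 P (hVU hPV), sub_self]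
  | zero => simp
  | add x y _ _ hx hy => simpa only [add_div] using add_mem hx hy
  | smul a x _ hx =>
    rw [Subring.smul_def, smul_eq_mul, mul_div_assoc]
    exact mul_mem (regular_le_localRing hyV a.2) hx

/-- Multiplication by a homogeneous function maps `𝓛(-D)` to `𝓛(-D')` if `D + (f) - D'` is
effective. -/
theorem mul_mem_lineSheaf (hw : IsFaithful w) {χ ψ : G →* ℂˣ} {D D' : Y.PrimeDivisor →₀ ℚ}
    (hD : Y.IsWeilDivisor χ D) (hD' : Y.IsWeilDivisor (ψ * χ) D') {f : RatFun n}
    (hf : HasWeight w ψ f) (h0 : f ≠ 0) (heff : ∀ P, 0 ≤ D P + Y.val P f - D' P)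
    {U : Y.Y.Opens} [Nonempty U] {s : RatFun n} (hs : s ∈ Y.lineSheaf χ D U) :
    f * s ∈ Y.lineSheaf (ψ * χ) D' U := by
  refine mem_lineSheaf_of_locally fun y hy => ?_
  obtain ⟨V, e, hyV, he⟩ := exists_isLocalEquation hw hD y
  obtain ⟨V', e', hyV', he'⟩ := exists_isLocalEquation hw hD' y
  have hne : Nonempty ((U ⊓ (V ⊓ V') : Y.Y.Opens)) := ⟨⟨y, hy, hyV, hyV'⟩⟩
  refine ⟨U ⊓ (V ⊓ V'), hne, ⟨hy, hyV, hyV'⟩, inf_le_left, ?_⟩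
  replace he := he.mono (inf_le_right.trans inf_le_left : U ⊓ (V ⊓ V') ≤ V)
  replace he' := he'.mono (inf_le_right.trans inf_le_right : U ⊓ (V ⊓ V') ≤ V')
  have h1 := he.div_mem_regular (lineSheaf_mono inf_le_left hs)
  -- The order of this invariant function along `P` is `D P + v_P(f) - D' P`, so effectivity
  -- excludes poles.
  have h2 : f * e / e' ∈ Y.regular (U ⊓ (V ⊓ V')) := by
    refine mem_regular_of_forall_mem_localRing fun z hz => ?_
    refine mem_localRing_of_val_nonneg (div_self' (ψ * χ) ▸ (hf.mul he.2.1).div he'.2.1)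
      (div_ne_zero (mul_ne_zero h0 he.1) he'.1) fun P hP => ?_
    have hPV := hP.mem_open (U ⊓ (V ⊓ V')).isOpen hz
    rw [val_div (hf.mul he.2.1) he'.2.1 (mul_ne_zero h0 he.1) he'.1,
      Y.val_mul hf he.2.1 h0 he.1, he.2.2 P hPV, he'.2.2 P hPV]
    linarith [heff P]
  have h3 : f * s = (s / e) * (f * e / e') * e' := by
    have := he.1
    have := he'.1
    field_simp
  rw [h3]
  exact he'.mul_mem_lineSheaf (mul_mem h1 h2)

end

end Resolution

end GConstellation

end

noncomputable section

namespace GConstellation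

/-! ### Eigenvectors in the regular representation -/

section MonoidAlgebra

variable {G : Type*} [CommGroup G] [Fintype G] {k : Type*} [Field k] (φ : ℂ →+* k)

/-- `|G|` times the idempotent of the group algebra which belongs to the character `χ⁻¹`. -/
def characterSum (χ : G →* ℂˣ) : MonoidAlgebra k G :=
  ∑ g : G, MonoidAlgebra.single g (φ ((χ g : ℂˣ) : ℂ))

/-- The eigenvalue `χ(g⁻¹)` is the one by which `g` acts on functions of weight `χ`, so
`characterSum φ χ` is the counterpart of a basis vector of weight `χ`. -/
theorem single_mul_characterSum (χ : G →* ℂˣ) (g : G) :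
    MonoidAlgebra.single g 1 * characterSum φ χ =
      φ ((χ g⁻¹ : ℂˣ) : ℂ) • characterSum φ χ := by
  rw [characterSum, Finset.mul_sum, Finset.smul_sum, ← Equiv.sum_comp (Equiv.mulLeft g)
    (fun h => φ ((χ g⁻¹ : ℂˣ) : ℂ) • MonoidAlgebra.single h (φ ((χ h : ℂˣ) : ℂ)))]
  refine Finset.sum_congr rfl fun h _ => ?_
  rw [MonoidAlgebra.single_mul_single, one_mul, Equiv.coe_mulLeft, MonoidAlgebra.smul_single,
    smul_eq_mul, ← map_mul, ← Units.val_mul, ← map_mul, inv_mul_cancel_left]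

/-- Fourier inversion, from the orthogonality of characters. As `|G|` is invertible in `k`, it shows
that the eigenvectors span the group algebra. -/
theorem sum_smul_characterSum (g : G) :
    ∑ χ : G →* ℂˣ, φ ((χ g⁻¹ : ℂˣ) : ℂ) • characterSum φ χ =
      MonoidAlgebra.single g (φ (Nat.card G)) := by
  have h (a : G) : ∑ χ : G →* ℂˣ, φ ((χ g⁻¹ : ℂˣ) : ℂ) •
      MonoidAlgebra.single a (φ ((χ a : ℂˣ) : ℂ)) =
        MonoidAlgebra.single a (φ (∑ χ : G →* ℂˣ, ((χ (g⁻¹ * a) : ℂˣ) : ℂ))) := by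
    rw [map_sum, ← MonoidAlgebra.singleAddHom_apply, map_sum]
    refine Finset.sum_congr rfl fun χ _ => ?_
    rw [MonoidAlgebra.smul_single, smul_eq_mul, ← map_mul, ← Units.val_mul, ← map_mul,
      MonoidAlgebra.singleAddHom_apply]
  simp only [characterSum, Finset.smul_sum]
  rw [Finset.sum_comm, Finset.sum_eq_single g]
  · rw [h]
    simp [card_characters]
  · intro a _ ha
    rw [h, sum_character_apply_eq_zero fun h0 => ha (inv_mul_eq_one.mp h0).symm, map_zero,
      MonoidAlgebra.single_zero]
  · simp

/-- The basis of the regular representation which consists of eigenvectors. -/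
def characterBasis : Module.Basis (G →* ℂˣ) k (MonoidAlgebra k G) :=
  basisOfTopLeSpanOfCardEqFinrank (characterSum φ)
    (by
      have hG : φ (Nat.card G) ≠ 0 :=
        (map_ne_zero φ).mpr (Nat.cast_ne_zero.mpr Nat.card_pos.ne')
      rintro x -
      induction x using MonoidAlgebra.induction_on with
      | of g =>
        have h : MonoidAlgebra.of k G g = (φ (Nat.card G))⁻¹ •
            ∑ χ : G →* ℂˣ, φ ((χ g⁻¹ : ℂˣ) : ℂ) • characterSum φ χ := by
          rw [sum_smul_characterSum, MonoidAlgebra.smul_single, smul_eq_mul, inv_mul_cancel₀ hG,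
            MonoidAlgebra.of_apply]
        rw [h]
        exact Submodule.smul_mem _ _ (sum_mem fun χ _ =>
          Submodule.smul_mem _ _ (Submodule.subset_span ⟨χ, rfl⟩))
      | add x y hx hy => exact add_mem hx hy
      | smul r x hx => exact Submodule.smul_mem _ _ hx)
    (by
      rw [card_characters, Nat.card_eq_fintype_card,
        Module.finrank_eq_card_basis (MonoidAlgebra.basis G k)])

theorem characterBasis_apply (χ : G →* ℂˣ) : characterBasis φ χ = characterSum φ χ := by
  simp [characterBasis]

end MonoidAlgebra

/-! ### Modules with one generator of each weight -/

section Basis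

variable {G : Type*} [CommGroup G] [Fintype G] {n : ℕ} {w : Fin n → (G →* ℂˣ)}

/-- The elements of `A` are invariant, so the weight projections are `A`-linear and isolate the
terms of a relation. -/
theorem linearIndependent_of_hasWeight {A : Subring (RatFun n)}
    (hA : ∀ a ∈ A, HasWeight w 1 a) {e : (G →* ℂˣ) → RatFun n}
    (he : ∀ χ, HasWeight w χ (e χ)) (h0 : ∀ χ, e χ ≠ 0) : LinearIndependent A e := by
  classical
  rw [Fintype.linearIndependent_iff]
  intro a ha χ
  have h := congrArg (weightProj w χ) ha
  rw [map_sum, map_zero, Finset.sum_eq_single χ] at h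
  · rw [Subring.smul_def, smul_eq_mul, weightProj_mul (hA _ (a χ).2),
      weightProj_of_hasWeight (he χ)] at h
    have hG : (Nat.card G : ℂ) ≠ 0 := Nat.cast_ne_zero.mpr Nat.card_pos.ne'
    simpa [h0 χ, Algebra.smul_def] using h
  · intro ψ _ hψ
    rw [Subring.smul_def, smul_eq_mul, weightProj_mul (hA _ (a ψ).2),
      weightProj_of_hasWeight_of_ne hψ.symm (he ψ), mul_zero]
  · simp

/-- A submodule of `K(ℂⁿ)` generated by functions of different weights, one for each character,
is free on them. -/
def basisOfHasWeight {A : Subring (RatFun n)} (hA : ∀ a ∈ A, HasWeight w 1 a)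
    (M : Submodule A (RatFun n)) (e : (G →* ℂˣ) → RatFun n) (he : ∀ χ, HasWeight w χ (e χ))
    (h0 : ∀ χ, e χ ≠ 0) (hM : Submodule.span A (Set.range e) = M) :
    Module.Basis (G →* ℂˣ) A M :=
  (Module.Basis.span (linearIndependent_of_hasWeight hA he h0)).map (LinearEquiv.ofEq _ _ hM)

theorem basisOfHasWeight_apply {A : Subring (RatFun n)} (hA : ∀ a ∈ A, HasWeight w 1 a)
    (M : Submodule A (RatFun n)) (e : (G →* ℂˣ) → RatFun n) (he : ∀ χ, HasWeight w χ (e χ))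
    (h0 : ∀ χ, e χ ≠ 0) (hM : Submodule.span A (Set.range e) = M) (χ : G →* ℂˣ) :
    (basisOfHasWeight hA M e he h0 hM χ : RatFun n) = e χ := by
  simp [basisOfHasWeight, Module.Basis.span_apply]

-- The isomorphism matches the basis vector of weight `χ` with the eigenvector `characterSum φ χ`.
-- It is equivariant because `g` acts on both by `χ(g⁻¹)`.
set_option synthInstance.maxHeartbeats 200000 in
theorem exists_tensorProduct_equiv_monoidAlgebra {A : Subring (RatFun n)}
    (hA : ∀ a ∈ A, HasWeight w 1 a) (hc : ∀ c, algebraMap ℂ (RatFun n) c ∈ A)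
    {k : Type*} [Field k] [Algebra A k]
    (M : Submodule A (RatFun n)) (e : (G →* ℂˣ) → RatFun n) (he : ∀ χ, HasWeight w χ (e χ))
    (h0 : ∀ χ, e χ ≠ 0) (hM : Submodule.span A (Set.range e) = M) :
    ∃ E : (k ⊗[A] M) ≃ₗ[k] MonoidAlgebra k G, ∀ (g : G) (x : k) (s t : M),
      (t : RatFun n) = actK w g s → E (x ⊗ₜ t) = MonoidAlgebra.single g 1 * E (x ⊗ₜ s) := by
  let c : ℂ →+* A := (algebraMap ℂ (RatFun n)).codRestrict _ hc
  let φ : ℂ →+* k := (algebraMap A k).comp c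
  let b := basisOfHasWeight hA M e he h0 hM
  have hb : ∀ χ, (b χ : RatFun n) = e χ := basisOfHasWeight_apply _ _ _ _ _ _
  let E := (b.baseChange k).equiv (characterBasis φ) (Equiv.refl _)
  have hE : ∀ x χ, E (x ⊗ₜ b χ) = x • characterSum φ χ := by
    intro x χ
    have h1 : x ⊗ₜ[A] b χ = x • (b.baseChange k χ) := by
      rw [Module.Basis.baseChange_apply, TensorProduct.smul_tmul', smul_eq_mul, mul_one]
    rw [h1, map_smul, Module.Basis.equiv_apply, Equiv.refl_apply, characterBasis_apply]
  have hE' : ∀ x (a : A) χ, E (x ⊗ₜ (a • b χ : M)) = (x * algebraMap A k a) • characterSum φ χ := by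
    intro x a χ
    rw [← TensorProduct.smul_tmul, Algebra.smul_def, mul_comm, hE]
  refine ⟨E, fun g x s t hst => ?_⟩
  have hs := b.sum_repr s
  have ht : t = ∑ χ, (b.repr s χ * c ((χ g⁻¹ : ℂˣ) : ℂ)) • b χ := by
    apply Subtype.ext
    rw [hst, ← congrArg Subtype.val hs, Submodule.coe_sum, Submodule.coe_sum, map_sum]
    refine Finset.sum_congr rfl fun χ _ => ?_
    rw [Submodule.coe_smul, Submodule.coe_smul, Subring.smul_def, Subring.smul_def, smul_eq_mul,
      smul_eq_mul, map_mul, (hA _ (b.repr s χ).2).actK_eq, hb, he χ g, Subring.coe_mul, mul_assoc,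
      Algebra.smul_def]
    rfl
  rw [ht, ← congrArg (x ⊗ₜ[A] ·) hs]
  simp only [TensorProduct.tmul_sum, map_sum, Finset.mul_sum, hE']
  refine Finset.sum_congr rfl fun χ _ => ?_
  rw [mul_smul_comm, single_mul_characterSum, smul_smul, map_mul, mul_assoc]
  rfl

end Basis

/-! ### The sheaf `⨁_χ 𝓛(-D_χ)` and its stability under `R` -/

namespace Resolution

variable {G : Type*} [CommGroup G] {n : ℕ} {w : Fin n → (G →* ℂˣ)} {Y : Resolution w}

theorem algebraMap_mem_regular (U : Y.Y.Opens) [Nonempty U] (c : ℂ) :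
    algebraMap ℂ (RatFun n) c ∈ Y.regular U := by
  refine ⟨Y.Y.presheaf.map (homOfLE le_top).op (Y.π.appTop
    ((Scheme.ΓSpecIso (CommRingCat.of (invariants w))).inv (algebraMap ℂ (invariants w) c))), ?_⟩
  have h1 := Y.toRatFun_pullbackInv (algebraMap ℂ (invariants w) c)
  refine Eq.trans ?_ (h1.trans ?_)
  · rw [RingHom.comp_apply]
    congr 1
    exact Y.Y.presheaf.germ_res_apply (homOfLE le_top) _ _ _
  · exact (IsScalarTower.algebraMap_apply ℂ (CoordRing n) (RatFun n) c).symm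

theorem algebraMap_mem_localRing (y : Y.Y) (c : ℂ) :
    algebraMap ℂ (RatFun n) c ∈ Y.localRing y :=
  have : Nonempty (⊤ : Y.Y.Opens) := ⟨⟨y, trivial⟩⟩
  regular_le_localRing (U := ⊤) trivial (algebraMap_mem_regular ⊤ c)

theorem smul_mem_of_regular {U : Y.Y.Opens} [Nonempty U] (M : Submodule (Y.regular U) (RatFun n))
    (c : ℂ) {s : RatFun n} (hs : s ∈ M) : c • s ∈ M := by
  rw [Algebra.smul_def]
  exact M.smul_mem (⟨_, algebraMap_mem_regular U c⟩ : Y.regular U) hs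

variable {D : (G →* ℂˣ) → (Y.PrimeDivisor →₀ ℚ)}

theorem mem_sumLineSheaf_of_mem {U : Y.Y.Opens} [Nonempty U] {χ : G →* ℂˣ} {s : RatFun n}
    (hs : s ∈ Y.lineSheaf χ (D χ) U) : s ∈ Y.sumLineSheaf D U :=
  Submodule.mem_iSup_of_mem χ hs

variable [Fintype G]

/-- Constants are regular, so dividing by `|G|` is allowed, and a section of the sum splits into its
weight components over the same open set. Questions about the sum thus reduce to the summands. -/
theorem mem_sumLineSheaf_iff {U : Y.Y.Opens} [Nonempty U] {s : RatFun n} :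
    s ∈ Y.sumLineSheaf D U ↔ ∀ χ, weightProj w χ s ∈ Y.lineSheaf χ (D χ) U := by
  constructor
  · intro hs χ
    refine Submodule.iSup_induction _ (motive := fun s => weightProj w χ s ∈ Y.lineSheaf χ (D χ) U)
      hs (fun ψ t ht => ?_) (by simp) fun x y hx hy => by simpa using add_mem hx hy
    have hwt := hasWeight_of_mem_lineSheaf ht
    by_cases hχ : χ = ψ
    · subst hχ
      rw [weightProj_of_hasWeight hwt]
      exact smul_mem_of_regular _ _ ht
    · rw [weightProj_of_hasWeight_of_ne hχ hwt]
      exact zero_mem _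
  · intro h
    have hG : (Nat.card G : ℂ) ≠ 0 := Nat.cast_ne_zero.mpr Nat.card_pos.ne'
    have : s = (Nat.card G : ℂ)⁻¹ • ∑ χ : G →* ℂˣ, weightProj w χ s := by
      rw [sum_weightProj, smul_smul, inv_mul_cancel₀ hG, one_smul]
    rw [this]
    exact smul_mem_of_regular _ _ (sum_mem fun χ _ => Submodule.mem_iSup_of_mem χ (h χ))

theorem mem_lineSheaf_of_mem_sumLineSheaf {U : Y.Y.Opens} [Nonempty U] {χ : G →* ℂˣ}
    {s : RatFun n} (hs : s ∈ Y.sumLineSheaf D U) (hχ : HasWeight w χ s) :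
    s ∈ Y.lineSheaf χ (D χ) U := by
  have hG : (Nat.card G : ℂ) ≠ 0 := Nat.cast_ne_zero.mpr Nat.card_pos.ne'
  have h := mem_sumLineSheaf_iff.mp hs χ
  rw [weightProj_of_hasWeight hχ] at h
  simpa [smul_smul, inv_mul_cancel₀ hG] using smul_mem_of_regular _ (Nat.card G : ℂ)⁻¹ h

theorem sumLineSheaf_mono {U V : Y.Y.Opens} [Nonempty U] [Nonempty V] (hVU : V ≤ U)
    {s : RatFun n} (hs : s ∈ Y.sumLineSheaf D U) : s ∈ Y.sumLineSheaf D V :=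
  mem_sumLineSheaf_iff.mpr fun χ => lineSheaf_mono hVU (mem_sumLineSheaf_iff.mp hs χ)

theorem isSubsheaf_sumLineSheaf : Y.IsSubsheaf fun U [Nonempty U] => Y.sumLineSheaf D U := by
  refine fun U _ s => ⟨fun V _ hVU hs => sumLineSheaf_mono hVU hs, fun h => ?_⟩
  refine mem_sumLineSheaf_iff.mpr fun χ => mem_lineSheaf_of_locally fun y hy => ?_
  obtain ⟨V, hV, hyV, hVU, hs⟩ := h y hy
  exact ⟨V, hV, hyV, hVU, mem_sumLineSheaf_iff.mp hs χ⟩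

theorem actK_mem_sumLineSheaf {U : Y.Y.Opens} [Nonempty U] (g : G) {s : RatFun n}
    (hs : s ∈ Y.sumLineSheaf D U) : actK w g s ∈ Y.sumLineSheaf D U := by
  refine mem_sumLineSheaf_iff.mpr fun χ => ?_
  rw [weightProj_actK]
  exact smul_mem_of_regular _ _ (mem_sumLineSheaf_iff.mp hs χ)

theorem span_range_eq_sumLineSheaf {U : Y.Y.Opens} [Nonempty U] {e : (G →* ℂˣ) → RatFun n}
    (he : ∀ χ, Y.IsLocalEquation χ (D χ) U (e χ)) :
    Submodule.span (Y.regular U) (Set.range e) = Y.sumLineSheaf D U := by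
  apply le_antisymm
  · rw [Submodule.span_le]
    rintro _ ⟨χ, rfl⟩
    exact mem_sumLineSheaf_of_mem (he χ).mem_lineSheaf
  · refine iSup_le fun χ s hs => ?_
    have h := (he χ).div_mem_regular hs
    rw [← div_mul_cancel₀ s (he χ).1]
    exact Submodule.smul_mem _ (⟨_, h⟩ : Y.regular U) (Submodule.subset_span ⟨χ, rfl⟩)

theorem span_range_eq_stalk_sumLineSheaf {U : Y.Y.Opens} {y : Y.Y} (hy : y ∈ U)
    {e : (G →* ℂˣ) → RatFun n} (he : ∀ χ, Y.IsLocalEquation χ (D χ) U (e χ)) :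
    Submodule.span (Y.localRing y) (Set.range e) =
      Y.stalk (fun U [Nonempty U] => Y.sumLineSheaf D U) y := by
  have hU : Nonempty U := ⟨⟨y, hy⟩⟩
  apply le_antisymm
  · rw [Submodule.span_le]
    rintro _ ⟨χ, rfl⟩
    exact Submodule.subset_span ⟨U, hU, hy, mem_sumLineSheaf_of_mem (he χ).mem_lineSheaf⟩
  · refine Submodule.span_le.mpr ?_
    rintro s ⟨V, hV, hyV, hs⟩
    have hne : Nonempty ((V ⊓ U : Y.Y.Opens)) := ⟨⟨y, hyV, hy⟩⟩
    replace hs := sumLineSheaf_mono (inf_le_left : V ⊓ U ≤ V) hs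
    change s ∈ Submodule.span (Y.localRing y) (Set.range e)
    rw [← span_range_eq_sumLineSheaf fun χ => (he χ).mono inf_le_right] at hs
    induction hs using Submodule.span_induction with
    | mem x hx => exact Submodule.subset_span hx
    | zero => exact zero_mem _
    | add x z _ _ hx hz => exact add_mem hx hz
    | smul a x _ hx =>
      exact Submodule.smul_mem _
        (⟨a, regular_le_localRing (U := V ⊓ U) ⟨hyV, hy⟩ a.2⟩ : Y.localRing y) hx

theorem isLocallyFree_sumLineSheaf (hw : IsFaithful w) (hD : Y.IsPrereductorSet D) :
    Y.IsLocallyFree fun U [Nonempty U] => Y.sumLineSheaf D U := by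
  intro y
  obtain ⟨U, e, hy, he⟩ := exists_forall_isLocalEquation hw hD y
  let E := Fintype.equivFin (G →* ℂˣ)
  refine ⟨U, hy, _, fun i => e (E.symm i), fun V _ hVU => ?_⟩
  refine ⟨(basisOfHasWeight (fun a ha => hasWeight_of_mem_regular ha) _ e (fun χ => (he χ).2.1)
    (fun χ => (he χ).1) (span_range_eq_sumLineSheaf fun χ => (he χ).mono hVU)).reindex E,
    fun i => ?_⟩
  rw [Module.Basis.reindex_apply, basisOfHasWeight_apply]

theorem stalk_genericPoint_sumLineSheaf (hw : IsFaithful w) (hD : Y.IsPrereductorSet D) :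
    Y.stalk (fun U [Nonempty U] => Y.sumLineSheaf D U) (genericPoint Y.Y) = ⊤ := by
  obtain ⟨U, e, hy, he⟩ := exists_forall_isLocalEquation hw hD (genericPoint Y.Y)
  rw [← span_range_eq_stalk_sumLineSheaf hy he, eq_top_iff]
  rintro s -
  have hG : (Nat.card G : ℂ) ≠ 0 := Nat.cast_ne_zero.mpr Nat.card_pos.ne'
  have : s = (Nat.card G : ℂ)⁻¹ • ∑ χ : G →* ℂˣ, weightProj w χ s := by
    rw [sum_weightProj, smul_smul, inv_mul_cancel₀ hG, one_smul]
  rw [this, Algebra.smul_def]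
  refine Submodule.smul_mem _ (⟨_, algebraMap_mem_localRing _ _⟩ : Y.localRing (genericPoint Y.Y))
    (sum_mem fun χ _ => ?_)
  -- The quotient by `e χ` is invariant, hence lies in `K(Y)`, which is the local ring at the
  -- generic point.
  obtain ⟨h, hh⟩ := Y.mem_range_toRatFun
    (div_self' χ ▸ (hasWeight_weightProj χ s).div (he χ).2.1)
  have hmem : weightProj w χ s / e χ ∈ Y.localRing (genericPoint Y.Y) := by
    refine ⟨h, ?_⟩
    rw [RingHom.comp_apply, RingHom.algebraMap_toAlgebra, TopCat.Presheaf.stalkSpecializes_refl]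
    exact hh
  rw [← div_mul_cancel₀ (weightProj w χ s) (he χ).1]
  exact Submodule.smul_mem _ (⟨_, hmem⟩ : Y.localRing (genericPoint Y.Y))
    (Submodule.subset_span ⟨χ, rfl⟩)

theorem isRegularFibre_sumLineSheaf (hw : IsFaithful w) (hD : Y.IsPrereductorSet D) (y : Y.Y) :
    Y.IsRegularFibre (fun U [Nonempty U] => Y.sumLineSheaf D U) y := by
  obtain ⟨U, e, hy, he⟩ := exists_forall_isLocalEquation hw hD y
  exact exists_tensorProduct_equiv_monoidAlgebra (fun a ha => hasWeight_of_mem_localRing ha)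
    (algebraMap_mem_localRing y) _ e (fun χ => (he χ).2.1) (fun χ => (he χ).1)
    (span_range_eq_stalk_sumLineSheaf hy he)

theorem isDeformationOfGenericOrbit_sumLineSheaf (hw : IsFaithful w) (hD : Y.IsPrereductorSet D)
    (h : ∀ (i : Fin n) (χ : G →* ℂˣ), Y.IsEffective
        (⇑(D χ) + Y.principal (algebraMap (CoordRing n) (RatFun n) (MvPolynomial.X i)) -
          ⇑(D (χ * w i)))) :
    Y.IsDeformationOfGenericOrbit fun U [Nonempty U] => Y.sumLineSheaf D U where
  isSubsheaf := isSubsheaf_sumLineSheaf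
  act_mem _ _ g _ hs := actK_mem_sumLineSheaf g hs
  mul_mem U _ f s hs := by
    induction f using MvPolynomial.induction_on with
    | C a =>
      have := smul_mem_of_regular _ a hs
      rwa [Algebra.smul_def, IsScalarTower.algebraMap_apply ℂ (CoordRing n) (RatFun n)] at this
    | add p q hp hq => rw [map_add, add_mul]; exact add_mem hp hq
    | mul_X p i hp =>
      -- By induction `p * s` is already a section, so only multiplication by one variable on each
      -- summand has to be checked.
      rw [mul_comm p, map_mul, mul_assoc]
      refine Submodule.iSup_induction _ (motive := fun t =>
        algebraMap (CoordRing n) (RatFun n) (MvPolynomial.X i) * t ∈ Y.sumLineSheaf D U)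
        hp (fun χ t ht => ?_) (by simp) fun x y hx hy => by rw [mul_add]; exact add_mem hx hy
      refine mem_sumLineSheaf_of_mem (χ := w i * χ) (mul_mem_lineSheaf hw (hD χ) (hD _)
        (hasWeight_X i) (by simp) (fun P => ?_) ht)
      have := h i χ P
      rwa [mul_comm χ] at this
  isLocallyFree := isLocallyFree_sumLineSheaf hw hD
  isRegularFibre := isRegularFibre_sumLineSheaf hw hD
  stalk_genericPoint := stalk_genericPoint_sumLineSheaf hw hD

/-- With local equations `e` near the generic point of `P`, stability puts `f e_χ` in the summand of
weight `χψ`. So `f e_χ / e_{χψ}` is regular at `P`, and its nonnegative order is the coefficient in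
question. -/
theorem IsDeformationOfGenericOrbit.isEffective (hw : IsFaithful w) (hD : Y.IsPrereductorSet D)
    (h : Y.IsDeformationOfGenericOrbit fun U [Nonempty U] => Y.sumLineSheaf D U)
    {f : CoordRing n} {ψ : G →* ℂˣ} (h0 : f ≠ 0)
    (hf : HasWeight w ψ (algebraMap (CoordRing n) (RatFun n) f)) (χ : G →* ℂˣ) :
    Y.IsEffective
      (⇑(D χ) + Y.principal (algebraMap (CoordRing n) (RatFun n) f) - ⇑(D (χ * ψ))) := by
  intro P
  obtain ⟨U, e, hy, he⟩ := exists_forall_isLocalEquation hw hD P.1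
  have hU : Nonempty U := ⟨⟨P.1, hy⟩⟩
  have h0' : algebraMap (CoordRing n) (RatFun n) f ≠ 0 := by simpa using h0
  have hwt : HasWeight w (χ * ψ) (algebraMap (CoordRing n) (RatFun n) f * e χ) := by
    rw [mul_comm χ]
    exact hf.mul (he χ).2.1
  have h1 := mem_lineSheaf_of_mem_sumLineSheaf
    (h.mul_mem U f _ (mem_sumLineSheaf_of_mem (he χ).mem_lineSheaf)) hwt
  have h2 := val_nonneg_of_mem_localRing (regular_le_localRing hy ((he _).div_mem_regular h1))
    (div_ne_zero (mul_ne_zero h0' (he χ).1) (he _).1)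
  rw [val_div hwt (he _).2.1 (mul_ne_zero h0' (he χ).1) (he _).1,
    Y.val_mul hf (he χ).2.1 h0' (he χ).1, (he χ).2.2 P hy, (he _).2.2 P hy] at h2
  simp only [Pi.add_apply, Pi.sub_apply, principal]
  linarith

end Resolution

end GConstellation

end

/-! ### The criterion for reductor sets -/

open GConstellation
theorem proposition3 {G : Type*} [CommGroup G] [Finite G] {n : ℕ} (w : Fin n → (G →* ℂˣ))
    (hw : IsFaithful w) (Y : Resolution w) (D : (G →* ℂˣ) → (Y.PrimeDivisor →₀ ℚ))
    (hD : Y.IsPrereductorSet D) :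
    (Y.IsReductorSet D ↔
      ∀ (f : CoordRing n) (ψ : G →* ℂˣ), f ≠ 0 →
        HasWeight w ψ (algebraMap (CoordRing n) (RatFun n) f) →
        ∀ χ : G →* ℂˣ, Y.IsEffective
          (⇑(D χ) + Y.principal (algebraMap (CoordRing n) (RatFun n) f) - ⇑(D (χ * ψ)))) ∧
    (Y.IsReductorSet D ↔
      ∀ (i : Fin n) (χ : G →* ℂˣ), Y.IsEffective
        (⇑(D χ) + Y.principal (algebraMap (CoordRing n) (RatFun n) (MvPolynomial.X i)) -
          ⇑(D (χ * w i)))) := by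
  cases nonempty_fintype G
  -- The conditions form a cycle: a reductor set gives effectivity for all homogeneous polynomials,
  -- in particular for the coordinates, and this gives back a reductor set.
  have h1 : Y.IsReductorSet D → ∀ (f : CoordRing n) (ψ : G →* ℂˣ), f ≠ 0 →
      HasWeight w ψ (algebraMap (CoordRing n) (RatFun n) f) →
      ∀ χ : G →* ℂˣ, Y.IsEffective
        (⇑(D χ) + Y.principal (algebraMap (CoordRing n) (RatFun n) f) - ⇑(D (χ * ψ))) :=
    fun h _ _ h0 hf χ => h.2.isEffective hw hD h0 hf χ
  have h2 := fun h => (⟨hD, Resolution.isDeformationOfGenericOrbit_sumLineSheaf hw hD h⟩ :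
    Y.IsReductorSet D)
  exact ⟨⟨h1, fun h => h2 fun i => h _ _ (MvPolynomial.X_ne_zero i) (hasWeight_X i)⟩,
    ⟨fun h i => h1 h _ _ (MvPolynomial.X_ne_zero i) (hasWeight_X i), h2⟩⟩
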